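/- Let $n\ge 0$ and let $\mathcal A=\{H_1,\dots,H_m\}$ be a finite multiarrangement of linear hyperplanes in $\mathbb R^n$ (repeats allowed, $m\ge 0$), with nonzero normal vectors $a_1,\dots,a_m\in\mathbb R^n$, and let $2\mathcal A$ be the multiarrangement of size $2m$ in which every $H_i$ is taken twice. Use the same symbols for the complexifications in $\mathbb C^n$. For a multiarrangement $\mathcal B$ of linear hyperplanes in $\mathbb C^n$ and a line $L=\mathbb C\cdot(\ell_1,\dots,\ell_n)\subseteq\mathbb C^n$, let $\lambda_L=\ell_1x_1+\cdots+\ell_nx_n$, let $\rho_{\mathcal B}(L)$ be the number of hyperplanes of $\mathcal B$, counted with multiplicity, that do not contain $L$, and let $$J_{\mathcal B,1}=\bigl(\lambda_L^{\rho_{\mathcal B}(L)+1} : L\subseteq\mathbb C^n\text{ a line}\bigr)\subseteq\mathbb C[x_1,\dots,x_n].$$ Let $\Omega_n=\mathbb C[x_1,\dots,x_n]\otimes\wedge\{\theta_1,\dots,\theta_n\}$, bigraded by degree in the $x$-variables and degree in the $\theta$-variables, with the operator $df=\sum_{i=1}^n(\partial f/\partial x_i)\,\theta_i$. Let $I_{\mathcal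 A}$ be the smallest two-sided ideal of $\Omega_n$ that contains $J_{\mathcal A,1}$ and is closed under $d$, and let $\mathcal E_{\mathcal A}=\Omega_n/I_{\mathcal A}$, with bigraded Hilbert series $\mathrm{Hilb}(\mathcal E_{\mathcal A};q,t)=\sum_{i,j\ge0}\dim_{\mathbb C}(\mathcal E_{\mathcal A})_{i,j}\,q^it^j$. Then $$\mathrm{Hilb}(\mathcal E_{\mathcal A};q,t)\big|_{(q,t)=(q^2,q)}=\mathrm{Hilb}\bigl(\mathbb C[x_1,\dots,x_n]/J_{2\mathcal A,1};q\bigr).$$ A generic deformation of $2\mathcal A$ is an affine arrangement in $\mathbb R^n$ obtained by translating each of the $2m$ hyperplanes of $2\mathcal A$ so that any subfamily of the translated hyperplanes has a common point if and only if its family of normal vectors is linearly independent. Generic deformations of $2\mathcal A$ exist, the space $\mathcal E_{\mathcal A}$ is finite-dimensional, and every generic deformation of $2\mathcal A$ has finitely many regions (connected components of the complement in $\mathbb R^n$ of the union of its hyperplanes), their number being $\dim_{\mathbb C}\mathcal E_{\mathcal A}$. -/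

import Mathlib

open scoped TensorProduct

noncomputable section

namespace Superzonotopal

/-- A multiarrangement of linear hyperplanes in `K ^ n`, indexed by `ι` (repeats are allowed):
each hyperplane is given by a nonzero normal vector. -/
structure Multiarrangement (K : Type*) [Field K] (n : ℕ) (ι : Type*) where
  /-- the coefficient vector of the linear form cutting out the `i`-th hyperplane -/
  normal : ι → Fin n → K
  normal_ne_zero : ∀ i, normal i ≠ 0

namespace Multiarrangement

variable {K : Type*} [Field K] {n : ℕ} {ι : Type*}

/-- The `i`-th hyperplane, `{x | normal i ⬝ᵥ x = 0}`. -/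
def hyperplane (A : Multiarrangement K n ι) (i : ι) : Submodule K (Fin n → K) :=
  LinearMap.ker (dotProductBilin K K (A.normal i))

/-- The doubled multiarrangement: every hyperplane is taken twice. -/
def double (A : Multiarrangement K n ι) : Multiarrangement K n (ι ⊕ ι) where
  normal := Sum.elim A.normal A.normal
  normal_ne_zero := by
    rintro (i | i)
    · exact A.normal_ne_zero i
    · exact A.normal_ne_zero i

/-- The complexification of a real multiarrangement. -/
def complexify (A : Multiarrangement ℝ n ι) : Multiarrangement ℂ n ι where
  normal i j := (A.normal i j : ℂ)
  normal_ne_zero i h :=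
    A.normal_ne_zero i (funext fun j => Complex.ofReal_eq_zero.mp (congrFun h j))

/-- The number of indices `i` such that the line spanned by `v` is not contained in the `i`-th
hyperplane. -/
def rho (A : Multiarrangement K n ι) (v : Fin n → K) : ℕ :=
  Set.ncard {i | ¬ (Submodule.span K {v} ≤ A.hyperplane i)}

/-- The affine translate `{x | normal i ⬝ᵥ x = b i}` of the `i`-th hyperplane. -/
def affineHyperplane (A : Multiarrangement K n ι) (b : ι → K) (i : ι) : Set (Fin n → K) :=
  {x | A.normal i ⬝ᵥ x = b i}

/-- The affine arrangement of the translates `A.affineHyperplane b i` is a generic deformation of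
`A`: a finite subfamily of the translates has a common point if and only if its normal vectors are
linearly independent. -/
def IsGenericDeformation (A : Multiarrangement K n ι) (b : ι → K) : Prop :=
  ∀ S : Finset ι, (⋂ i ∈ S, A.affineHyperplane b i).Nonempty ↔
    LinearIndependent K (fun i : S => A.normal i)

/-- The complement in `ℝ ^ n` of the union of the affine hyperplanes `A.affineHyperplane b i`. -/
def affineComplement (A : Multiarrangement ℝ n ι) (b : ι → ℝ) : Set (Fin n → ℝ) :=
  (⋃ i, A.affineHyperplane b i)ᶜ

/-- The regions of the affine arrangement `A.affineHyperplane b`: the connected components of its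
complement. -/
def regions (A : Multiarrangement ℝ n ι) (b : ι → ℝ) : Set (Set (Fin n → ℝ)) :=
  (connectedComponentIn (A.affineComplement b)) '' (A.affineComplement b)

end Multiarrangement

/-- The linear form `v₁ x₁ + ⋯ + vₙ xₙ`. -/
def linearForm {n : ℕ} (v : Fin n → ℂ) : MvPolynomial (Fin n) ℂ :=
  ∑ i, MvPolynomial.C (v i) * MvPolynomial.X i

/-- The power ideal `J_{A,k}` of `ℂ[x₁, …, xₙ]`, generated by the powers `λ_L ^ (ρ_A(L) + k)` for
all lines `L = ℂ v` in `ℂ ^ n`. -/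
def powerIdeal {n : ℕ} {ι : Type*} (A : Multiarrangement ℂ n ι) (k : ℕ) :
    Ideal (MvPolynomial (Fin n) ℂ) :=
  Ideal.span {p | ∃ v : Fin n → ℂ, v ≠ 0 ∧ p = linearForm v ^ (A.rho v + k)}

/-- The superspace ring `Ωₙ = ℂ[x₁, …, xₙ] ⊗ ⋀{θ₁, …, θₙ}`. -/
abbrev Superspace (n : ℕ) : Type :=
  MvPolynomial (Fin n) ℂ ⊗[ℂ] ExteriorAlgebra ℂ (Fin n → ℂ)

/-- The fermionic generator `θᵢ` of the exterior algebra. -/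
def theta {n : ℕ} (i : Fin n) : ExteriorAlgebra ℂ (Fin n → ℂ) :=
  ExteriorAlgebra.ι ℂ (Pi.single i 1)

/-- The Euler operator `d f = ∑ᵢ (∂f/∂xᵢ) θᵢ`, that is
`d (p ⊗ ω) = ∑ᵢ (∂p/∂xᵢ) ⊗ (ω θᵢ)`. -/
def euler (n : ℕ) : Superspace n →ₗ[ℂ] Superspace n :=
  ∑ i : Fin n, TensorProduct.map (MvPolynomial.pderiv i).toLinearMap
    (LinearMap.mulRight ℂ (theta i))

/-- The bihomogeneous component of `Ωₙ` of bosonic degree `i` and fermionic degree `j`, namely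
the image of `ℂ[x]_i ⊗ ⋀^j`. -/
def bidegree (n i j : ℕ) : Submodule ℂ (Superspace n) :=
  LinearMap.range (TensorProduct.mapIncl (MvPolynomial.homogeneousSubmodule (Fin n) ℂ i)
    (⋀[ℂ]^j (Fin n → ℂ)))

/-- The differential closure of an ideal `J` of `ℂ[x₁, …, xₙ]`: the smallest two-sided ideal of
`Ωₙ` that is closed under `d` and contains `J`. -/
def differentialClosure {n : ℕ} (J : Ideal (MvPolynomial (Fin n) ℂ)) : Ideal (Superspace n) :=
  sInf {I | I.IsTwoSided ∧ (∀ f ∈ I, euler n f ∈ I) ∧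
    ∀ p ∈ J, p ⊗ₜ[ℂ] (1 : ExteriorAlgebra ℂ (Fin n → ℂ)) ∈ I}

/-- The superspace ideal `I_A`. -/
def superIdeal {n : ℕ} {ι : Type*} (A : Multiarrangement ℂ n ι) : Ideal (Superspace n) :=
  differentialClosure (powerIdeal A 1)

/-- The superspace external algebra `E_A = Ωₙ / I_A`. -/
abbrev SuperExternal {n : ℕ} {ι : Type*} (A : Multiarrangement ℂ n ι) : Type :=
  Superspace n ⧸ superIdeal A

/-- The Hilbert series `Hilb(ℂ[x₁, …, xₙ] / J; q)`; the degree `i` piece of the quotient is the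
image of the homogeneous polynomials of degree `i`. -/
def hilbPoly {n : ℕ} (J : Ideal (MvPolynomial (Fin n) ℂ)) : PowerSeries ℤ :=
  PowerSeries.mk fun i => (Module.finrank ℂ
    ((MvPolynomial.homogeneousSubmodule (Fin n) ℂ i).map
      ((Submodule.mkQ J).restrictScalars ℂ)) : ℤ)

/-- The bigraded Hilbert series `Hilb(Ωₙ / I; q, t)`, with `q` the variable `0` and `t` the
variable `1`; the bidegree `(i, j)` piece of the quotient is the image of `(Ωₙ)_{i,j}`. -/
def hilbSuper {n : ℕ} (I : Ideal (Superspace n)) : MvPowerSeries (Fin 2) ℤ :=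
  fun e => (Module.finrank ℂ
    ((bidegree n (e 0) (e 1)).map ((Submodule.mkQ I).restrictScalars ℂ)) : ℤ)

end Superzonotopal

end

/-!
Write `λ_v` and `dλ_v` for the bosonic and the fermionic linear form with coefficient vector `v`.
The superspace ideal is spanned by the multiples of `λ_v ^ (ρ v + 1)` and `λ_v ^ (ρ v) dλ_v`, and
this description also makes sense when `v` is confined to a subspace `C`. Adding a hyperplane with
covector `a` is a deletion–restriction step: differentiation along `a` maps the span for `a ::ₘ l`
and `C` onto the span for `l` and `C`, and on the constants of this derivation the former span
agrees with the one for `l` and `C ⊓ ker a`. Hence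

  `Hilb (a ::ₘ l, C) = q Hilb (l, C) + (1 - q) Hilb (l, C ⊓ ker a)`.

Applying this twice with the same `a` gives the coefficients `q ^ 2` and
`(1 - q) (1 + q) = 1 - q ^ 2`, which are those of a single step at `(q ^ 2, q)`; the bosonic series
is the one at `t = 0`. After clearing a factor `1 - q` for each dimension lost in `C`, the recursion
at `q = 1` becomes the one that counts the regions cut out on a flat of a generic deformation: a
transverse hyperplane adds as many regions as its trace has, and a hyperplane parallel to the flat
misses it by genericity.
-/

noncomputable section

namespace Superzonotopal

section

/-! ### The superspace ring -/

variable {n : ℕ} (a b : Module.Dual ℂ (Fin n → ℂ)) (v w : Fin n → ℂ) (f g : Superspace n)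

/-- The bosonic element `λ_v` of `Ωₙ`, as a linear function of `v`. -/
def bos : (Fin n → ℂ) →ₗ[ℂ] Superspace n :=
  (TensorProduct.mk ℂ _ _).flip 1 ∘ₗ Fintype.linearCombination ℂ MvPolynomial.X

/-- The fermionic element `dλ_v` of `Ωₙ`, as a linear function of `v`. -/
def fer : (Fin n → ℂ) →ₗ[ℂ] Superspace n :=
  TensorProduct.mk ℂ _ _ 1 ∘ₗ ExteriorAlgebra.ι ℂ

/-- The derivation of `ℂ[x₁, …, xₙ]` with `λ_v ↦ a v`. -/
def polyDeriv : Derivation ℂ (MvPolynomial (Fin n) ℂ) (MvPolynomial (Fin n) ℂ) :=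
  ∑ i, a (Pi.single i 1) • MvPolynomial.pderiv i

/-- The bosonic directional derivative on `Ωₙ`: the derivation with `λ_v ↦ a v` that kills the
fermionic variables. -/
def dBos : Superspace n →ₗ[ℂ] Superspace n :=
  LinearMap.rTensor _ (polyDeriv a).toLinearMap

/-- The fermionic contraction on `Ωₙ`: the antiderivation with `dλ_v ↦ a v` that kills the
bosonic variables. -/
def dFer : Superspace n →ₗ[ℂ] Superspace n :=
  LinearMap.lTensor _ (CliffordAlgebra.contractLeft (Q := (0 : QuadraticForm ℂ (Fin n → ℂ))) a)

lemma bos_apply : bos v = linearForm v ⊗ₜ 1 := by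
  simp [bos, linearForm, Fintype.linearCombination_apply, MvPolynomial.smul_eq_C_mul,
    TensorProduct.sum_tmul]

lemma fer_apply : fer v = 1 ⊗ₜ ExteriorAlgebra.ι ℂ v := rfl

lemma linearForm_single (i : Fin n) : linearForm (Pi.single i 1) = MvPolynomial.X i := by
  simp [linearForm, Pi.single_apply, ite_mul]

lemma polyDeriv_apply (p : MvPolynomial (Fin n) ℂ) :
    polyDeriv a p = ∑ i, a (Pi.single i 1) • MvPolynomial.pderiv i p := by
  rw [polyDeriv, ← Derivation.coeFnAddMonoidHom_apply, map_sum, Finset.sum_apply]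
  rfl

lemma polyDeriv_X (i : Fin n) :
    polyDeriv a (MvPolynomial.X i) = MvPolynomial.C (a (Pi.single i 1)) := by
  simp [polyDeriv_apply, MvPolynomial.pderiv_X, Pi.single_apply, MvPolynomial.smul_eq_C_mul]

lemma polyDeriv_linearForm : polyDeriv a (linearForm v) = MvPolynomial.C (a v) := by
  have h : a v = ∑ i, v i * a (Pi.single i 1) := by
    conv_lhs => rw [pi_eq_sum_univ' v, map_sum]
    simp only [map_smul, smul_eq_mul]
  simp [linearForm, polyDeriv_X, h]

-- `Ωₙ` carries two propositionally equal negations, so `rw [mul_neg]` does not see through it.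
lemma superspace_mul_neg : f * -g = -(f * g) := mul_neg f g

lemma superspace_neg_mul : -f * g = -(f * g) := neg_mul f g

lemma superspace_mul_sub (h : Superspace n) : f * (g - h) = f * g - f * h := mul_sub f g h

lemma bos_mul_comm : bos v * f = f * bos v := by
  rw [bos_apply]
  induction f using TensorProduct.induction_on with
  | zero => simp only [mul_zero, zero_mul]
  | tmul p ω => simp [mul_comm]
  | add f g hf hg => rw [mul_add, add_mul, hf, hg]

lemma bos_pow_mul_comm (k : ℕ) : bos v ^ k * f = f * bos v ^ k :=
  (Commute.pow_left (bos_mul_comm v f) k).eq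

lemma fer_mul_self : fer v * fer v = 0 := by
  simp [fer_apply]

lemma fer_mul_fer : fer v * fer w = -(fer w * fer v) := by
  rw [eq_neg_iff_add_eq_zero]
  simp [fer_apply, ← TensorProduct.tmul_add]

lemma dBos_one : dBos a 1 = 0 := by
  simp [dBos, Algebra.TensorProduct.one_def]

lemma dFer_one : dFer a 1 = 0 := by
  simp [dFer, Algebra.TensorProduct.one_def]

lemma dBos_bos_mul : dBos a (bos v * f) = a v • f + bos v * dBos a f := by
  rw [bos_apply]
  induction f using TensorProduct.induction_on with
  | zero => simp only [mul_zero, map_zero, smul_zero, add_zero]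
  | tmul p ω =>
    simp [dBos, polyDeriv_linearForm, TensorProduct.smul_tmul', ← TensorProduct.add_tmul,
      MvPolynomial.smul_eq_C_mul, mul_comm, add_comm]
  | add f g hf hg => simp only [mul_add, map_add, hf, hg, smul_add]; abel

lemma dBos_fer_mul : dBos a (fer v * f) = fer v * dBos a f := by
  induction f using TensorProduct.induction_on with
  | zero => simp only [mul_zero, map_zero]
  | tmul p ω => simp [dBos, fer_apply]
  | add f g hf hg => rw [mul_add, map_add, hf, hg, map_add, mul_add]

lemma dFer_bos_mul : dFer a (bos v * f) = bos v * dFer a f := by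
  rw [bos_apply]
  induction f using TensorProduct.induction_on with
  | zero => simp only [mul_zero, map_zero]
  | tmul p ω => simp [dFer]
  | add f g hf hg => rw [mul_add, map_add, hf, hg, map_add, mul_add]

lemma dFer_fer_mul : dFer a (fer v * f) = a v • f - fer v * dFer a f := by
  induction f using TensorProduct.induction_on with
  | zero => simp only [mul_zero, map_zero, smul_zero, sub_zero]
  | tmul p ω =>
    simp only [dFer, fer_apply, Algebra.TensorProduct.tmul_mul_tmul, one_mul,
      LinearMap.lTensor_tmul, ← TensorProduct.tmul_smul, ← TensorProduct.tmul_sub]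
    exact congrArg _ (CliffordAlgebra.contractLeft_ι_mul a v ω)
  | add f g hf hg => simp only [mul_add, map_add, hf, hg, smul_add]; abel

lemma dBos_bos_pow_mul (k : ℕ) :
    dBos a (bos v ^ (k + 1) * f) =
      ((k + 1 : ℕ) * a v) • (bos v ^ k * f) + bos v ^ (k + 1) * dBos a f := by
  induction k generalizing f with
  | zero => simp only [zero_add, pow_one, Nat.cast_one, one_mul, pow_zero, dBos_bos_mul]
  | succ k ih =>
    rw [pow_succ', mul_assoc, dBos_bos_mul, ih, mul_add, mul_smul_comm, ← mul_assoc, ← pow_succ',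
      ← mul_assoc, ← pow_succ', ← add_assoc, ← add_smul]
    congr 2
    push_cast
    ring

variable {a v} in
lemma dBos_bos_pow_mul_of_eq_zero (h : a v = 0) (k : ℕ) :
    dBos a (bos v ^ k * f) = bos v ^ k * dBos a f := by
  cases k with
  | zero => simp only [pow_zero, one_mul]
  | succ k => rw [dBos_bos_pow_mul, h, mul_zero, zero_smul, zero_add]

lemma dFer_bos_pow_mul (k : ℕ) : dFer a (bos v ^ k * f) = bos v ^ k * dFer a f := by
  induction k with
  | zero => simp only [pow_zero, one_mul]
  | succ k ih => rw [pow_succ', mul_assoc, dFer_bos_mul, ih, mul_assoc]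

lemma dBos_comm : dBos a (dBos b f) = dBos b (dBos a f) := by
  have h : ⁅polyDeriv a, polyDeriv b⁆ = 0 :=
    MvPolynomial.derivation_ext fun i => by
      simp [Derivation.commutator_apply, polyDeriv_X]
  have hcomp : (polyDeriv a).toLinearMap ∘ₗ (polyDeriv b).toLinearMap =
      (polyDeriv b).toLinearMap ∘ₗ (polyDeriv a).toLinearMap :=
    LinearMap.ext fun p => sub_eq_zero.mp (DFunLike.congr_fun h p)
  simp only [dBos, ← LinearMap.comp_apply, ← LinearMap.rTensor_comp, hcomp]

lemma dBos_dFer : dBos a (dFer b f) = dFer b (dBos a f) := by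
  simp only [dBos, dFer, ← LinearMap.comp_apply, LinearMap.rTensor_comp_lTensor,
    LinearMap.lTensor_comp_rTensor]

lemma dFer_dFer : dFer a (dFer b f) = -dFer b (dFer a f) := by
  induction f using TensorProduct.induction_on with
  | zero => simp only [map_zero, neg_zero]
  | tmul p ω =>
    simp only [dFer, LinearMap.lTensor_tmul, ← TensorProduct.tmul_neg,
      ← CliffordAlgebra.contractLeft_comm]
  | add f g hf hg => simp only [map_add, hf, hg, neg_add]

lemma dFer_self : dFer a (dFer a f) = 0 := by
  simp only [dFer, ← LinearMap.comp_apply, ← LinearMap.lTensor_comp]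
  rw [show CliffordAlgebra.contractLeft a ∘ₗ CliffordAlgebra.contractLeft a = 0 from
    LinearMap.ext (CliffordAlgebra.contractLeft_contractLeft a), LinearMap.lTensor_zero,
    LinearMap.zero_apply]

theorem superspace_induction {P : Superspace n → Prop} (one : P 1)
    (smul : ∀ (c : ℂ) f, P f → P (c • f)) (add : ∀ f g, P f → P g → P (f + g))
    (bos_mul : ∀ v f, P f → P (bos v * f)) (fer_mul : ∀ v f, P f → P (fer v * f))
    (f : Superspace n) : P f := by
  have one_tmul (ω : ExteriorAlgebra ℂ (Fin n → ℂ)) : P (1 ⊗ₜ ω) := by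
    induction ω using CliffordAlgebra.left_induction with
    | algebraMap r =>
      simpa [Algebra.TensorProduct.one_def, ← TensorProduct.tmul_smul,
        ← Algebra.algebraMap_eq_smul_one] using smul r _ one
    | add x y hx hy => rw [TensorProduct.tmul_add]; exact add _ _ hx hy
    | ι_mul x m hx =>
      have := fer_mul m _ hx
      rwa [fer_apply, Algebra.TensorProduct.tmul_mul_tmul, one_mul] at this
  induction f using TensorProduct.induction_on with
  | zero => simpa only [zero_smul] using smul 0 _ one
  | tmul p ω =>
    induction p using MvPolynomial.induction_on with
    | C c =>
      simpa [TensorProduct.smul_tmul', MvPolynomial.smul_eq_C_mul] using smul c _ (one_tmul ω)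
    | add p q hp hq => rw [TensorProduct.add_tmul]; exact add _ _ hp hq
    | mul_X p i hp =>
      have := bos_mul (Pi.single i 1) _ hp
      rwa [bos_apply, Algebra.TensorProduct.tmul_mul_tmul, one_mul, linearForm_single,
        mul_comm] at this
  | add f g hf hg => exact add _ _ hf hg

lemma exists_mul_fer : ∃ f', ∀ v, f * fer v = fer v * f' := by
  induction f using superspace_induction with
  | one => exact ⟨1, fun v => by rw [one_mul, mul_one]⟩
  | smul c f h =>
    obtain ⟨f', h⟩ := h
    exact ⟨c • f', fun v => by rw [smul_mul_assoc, mul_smul_comm, h]⟩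
  | add f g hf hg =>
    obtain ⟨f', hf⟩ := hf; obtain ⟨g', hg⟩ := hg
    exact ⟨f' + g', fun v => by rw [add_mul, mul_add, hf, hg]⟩
  | bos_mul w f h =>
    obtain ⟨f', h⟩ := h
    exact ⟨bos w * f', fun v => by rw [mul_assoc, h, ← mul_assoc, ← mul_assoc, bos_mul_comm]⟩
  | fer_mul w f h =>
    obtain ⟨f', h⟩ := h
    exact ⟨-(fer w * f'), fun v => by
      rw [mul_assoc, h, ← mul_assoc, fer_mul_fer, superspace_mul_neg, superspace_neg_mul,
        mul_assoc]⟩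

end

section

variable {n i j : ℕ} (a : Module.Dual ℂ (Fin n → ℂ)) (v : Fin n → ℂ) {f : Superspace n}

lemma tmul_mem_bidegree {p : MvPolynomial (Fin n) ℂ} {ω : ExteriorAlgebra ℂ (Fin n → ℂ)}
    (hp : p ∈ MvPolynomial.homogeneousSubmodule (Fin n) ℂ i) (hω : ω ∈ ⋀[ℂ]^j (Fin n → ℂ)) :
    p ⊗ₜ[ℂ] ω ∈ bidegree n i j :=
  ⟨⟨p, hp⟩ ⊗ₜ ⟨ω, hω⟩, rfl⟩

lemma bidegree_le {N : Submodule ℂ (Superspace n)}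
    (h : ∀ p ∈ MvPolynomial.homogeneousSubmodule (Fin n) ℂ i, ∀ ω ∈ ⋀[ℂ]^j (Fin n → ℂ),
      p ⊗ₜ[ℂ] ω ∈ N) : bidegree n i j ≤ N := by
  rintro _ ⟨t, rfl⟩
  induction t using TensorProduct.induction_on with
  | zero => rw [map_zero]; exact N.zero_mem
  | tmul p ω => exact h p p.2 ω ω.2
  | add x y hx hy => rw [map_add]; exact N.add_mem hx hy

instance bidegree_finite : Module.Finite ℂ (bidegree n i j) := by
  have : Module.Finite ℂ (MvPolynomial.homogeneousSubmodule (Fin n) ℂ i) :=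
    Module.Finite.iff_fg.mpr (MvPolynomial.homogeneousSubmodule_fg (σ := Fin n) (R := ℂ) i)
  rw [bidegree]
  infer_instance

lemma eq_C_of_mem_homogeneousSubmodule_zero {p : MvPolynomial (Fin n) ℂ}
    (hp : p ∈ MvPolynomial.homogeneousSubmodule (Fin n) ℂ 0) :
    p = MvPolynomial.C (p.coeff 0) :=
  MvPolynomial.totalDegree_eq_zero_iff_eq_C.mp
    (Nat.le_zero.mp (MvPolynomial.IsHomogeneous.totalDegree_le hp))

lemma exists_algebraMap_eq_of_mem_exteriorPower_zero {ω : ExteriorAlgebra ℂ (Fin n → ℂ)}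
    (hω : ω ∈ ⋀[ℂ]^0 (Fin n → ℂ)) : ∃ c, algebraMap ℂ _ c = ω := by
  simpa [Submodule.mem_one] using hω

lemma one_mem_bidegree : (1 : Superspace n) ∈ bidegree n 0 0 :=
  tmul_mem_bidegree (MvPolynomial.isHomogeneous_one _ _) (by simp)

lemma bidegree_zero_zero (n : ℕ) : bidegree n 0 0 = Submodule.span ℂ {1} := by
  refine le_antisymm (bidegree_le fun p hp ω hω => ?_)
    ((Submodule.span_singleton_le_iff_mem _ _).mpr one_mem_bidegree)
  obtain ⟨c, rfl⟩ := exists_algebraMap_eq_of_mem_exteriorPower_zero hω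
  rw [eq_C_of_mem_homogeneousSubmodule_zero hp, ← MvPolynomial.algebraMap_eq,
    Algebra.algebraMap_eq_smul_one, Algebra.algebraMap_eq_smul_one, ← TensorProduct.smul_tmul',
    TensorProduct.tmul_smul, smul_smul]
  exact Submodule.smul_mem _ _ (Submodule.mem_span_singleton_self _)

lemma bos_mul_mem_bidegree (hf : f ∈ bidegree n i j) : bos v * f ∈ bidegree n (i + 1) j := by
  suffices h : bidegree n i j ≤ (bidegree n (i + 1) j).comap (LinearMap.mulLeft ℂ (bos v)) from
    h hf
  refine bidegree_le fun p hp ω hω => ?_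
  have hv : (linearForm v).IsHomogeneous 1 := by
    refine MvPolynomial.IsHomogeneous.sum _ _ _ fun k _ => ?_
    simpa using (MvPolynomial.isHomogeneous_C (Fin n) (v k)).mul (MvPolynomial.isHomogeneous_X ℂ k)
  rw [Submodule.mem_comap, LinearMap.mulLeft_apply, bos_apply,
    Algebra.TensorProduct.tmul_mul_tmul, one_mul, add_comm i]
  exact tmul_mem_bidegree (hv.mul hp) hω

lemma bos_pow_mul_mem_bidegree (k : ℕ) (hf : f ∈ bidegree n i j) :
    bos v ^ k * f ∈ bidegree n (i + k) j := by
  induction k with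
  | zero => rwa [pow_zero, one_mul]
  | succ k ih => rw [pow_succ', mul_assoc]; exact bos_mul_mem_bidegree v ih

lemma fer_mul_mem_bidegree (hf : f ∈ bidegree n i j) : fer v * f ∈ bidegree n i (j + 1) := by
  suffices h : bidegree n i j ≤ (bidegree n i (j + 1)).comap (LinearMap.mulLeft ℂ (fer v)) from
    h hf
  refine bidegree_le fun p hp ω hω => ?_
  rw [Submodule.mem_comap, LinearMap.mulLeft_apply, fer_apply,
    Algebra.TensorProduct.tmul_mul_tmul, one_mul]
  refine tmul_mem_bidegree hp ?_
  rw [ExteriorAlgebra.exteriorPower, pow_succ']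
  exact Submodule.mul_mem_mul ⟨v, rfl⟩ hω

lemma polyDeriv_mem_homogeneousSubmodule {p : MvPolynomial (Fin n) ℂ}
    (hp : p ∈ MvPolynomial.homogeneousSubmodule (Fin n) ℂ (i + 1)) :
    polyDeriv a p ∈ MvPolynomial.homogeneousSubmodule (Fin n) ℂ i := by
  rw [polyDeriv_apply]
  exact Submodule.sum_mem _ fun k _ => Submodule.smul_mem _ _
    (MvPolynomial.IsHomogeneous.pderiv (n := i + 1) hp)

lemma dBos_mem_bidegree (hf : f ∈ bidegree n (i + 1) j) : dBos a f ∈ bidegree n i j := by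
  suffices h : bidegree n (i + 1) j ≤ (bidegree n i j).comap (dBos a) from h hf
  refine bidegree_le fun p hp ω hω => ?_
  rw [Submodule.mem_comap, dBos, LinearMap.rTensor_tmul]
  exact tmul_mem_bidegree (polyDeriv_mem_homogeneousSubmodule a hp) hω

lemma dBos_eq_zero_of_mem_bidegree (hf : f ∈ bidegree n 0 j) : dBos a f = 0 := by
  suffices h : bidegree n 0 j ≤ LinearMap.ker (dBos a) from h hf
  refine bidegree_le fun p hp ω _ => ?_
  rw [LinearMap.mem_ker, dBos, LinearMap.rTensor_tmul, eq_C_of_mem_homogeneousSubmodule_zero hp,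
    Derivation.coeFn_coe, MvPolynomial.derivation_C, TensorProduct.zero_tmul]

lemma contractLeft_mem_exteriorPower {ω : ExteriorAlgebra ℂ (Fin n → ℂ)}
    (hω : ω ∈ ⋀[ℂ]^(j + 1) (Fin n → ℂ)) :
    CliffordAlgebra.contractLeft (Q := (0 : QuadraticForm ℂ (Fin n → ℂ))) a ω ∈
      ⋀[ℂ]^j (Fin n → ℂ) := by
  induction j generalizing ω with
  | zero =>
    rw [zero_add, ExteriorAlgebra.exteriorPower, pow_one] at hω
    obtain ⟨v, rfl⟩ := hω
    rw [ExteriorAlgebra.exteriorPower, pow_zero, ExteriorAlgebra.ι, CliffordAlgebra.contractLeft_ι]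
    exact Submodule.mem_one.mpr ⟨_, rfl⟩
  | succ j ih =>
    rw [ExteriorAlgebra.exteriorPower, pow_succ'] at hω
    induction hω using Submodule.mul_induction_on' with
    | mem_mul_mem x hx y hy =>
      obtain ⟨v, rfl⟩ := hx
      rw [ExteriorAlgebra.ι, CliffordAlgebra.contractLeft_ι_mul]
      refine Submodule.sub_mem _ (Submodule.smul_mem _ _ hy) ?_
      rw [ExteriorAlgebra.exteriorPower, pow_succ']
      exact Submodule.mul_mem_mul ⟨v, rfl⟩ (ih hy)
    | add x _ y _ hx hy => rw [map_add]; exact Submodule.add_mem _ hx hy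

lemma dFer_mem_bidegree (hf : f ∈ bidegree n i (j + 1)) : dFer a f ∈ bidegree n i j := by
  suffices h : bidegree n i (j + 1) ≤ (bidegree n i j).comap (dFer a) from h hf
  refine bidegree_le fun p hp ω hω => ?_
  rw [Submodule.mem_comap, dFer, LinearMap.lTensor_tmul]
  exact tmul_mem_bidegree hp (contractLeft_mem_exteriorPower a hω)

lemma dFer_eq_zero_of_mem_bidegree (hf : f ∈ bidegree n i 0) : dFer a f = 0 := by
  suffices h : bidegree n i 0 ≤ LinearMap.ker (dFer a) from h hf
  refine bidegree_le fun p _ ω hω => ?_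
  obtain ⟨c, rfl⟩ := exists_algebraMap_eq_of_mem_exteriorPower_zero hω
  have hc := CliffordAlgebra.contractLeft_algebraMap (Q := (0 : QuadraticForm ℂ (Fin n → ℂ))) a c
  rw [LinearMap.mem_ker, dFer, LinearMap.lTensor_tmul, hc, TensorProduct.tmul_zero]

/-- The projection of `Ωₙ` onto the bihomogeneous component of bidegree `e`. -/
def bidegreeProj (n : ℕ) (e : ℕ × ℕ) : Superspace n →ₗ[ℂ] Superspace n :=
  TensorProduct.map (MvPolynomial.homogeneousComponent e.1)
    (GradedAlgebra.proj (fun k : ℕ => ⋀[ℂ]^k (Fin n → ℂ)) e.2)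

lemma bidegreeProj_of_mem (hf : f ∈ bidegree n i j) (e : ℕ × ℕ) :
    bidegreeProj n e f = if e = (i, j) then f else 0 := by
  suffices h : bidegree n i j ≤ LinearMap.eqLocus (bidegreeProj n e)
      (if e = (i, j) then LinearMap.id else 0) by
    rw [LinearMap.mem_eqLocus.mp (h hf)]
    split_ifs <;> rfl
  refine bidegree_le fun p hp ω hω => ?_
  rw [LinearMap.mem_eqLocus, bidegreeProj, TensorProduct.map_tmul,
    MvPolynomial.homogeneousComponent_of_mem hp, GradedAlgebra.proj_apply]
  obtain ⟨k, l⟩ := e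
  rcases eq_or_ne k i with rfl | hi
  · rcases eq_or_ne l j with rfl | hj
    · simp [DirectSum.decompose_of_mem_same (fun k : ℕ => ⋀[ℂ]^k (Fin n → ℂ)) hω]
    · simp [DirectSum.decompose_of_mem_ne (fun k : ℕ => ⋀[ℂ]^k (Fin n → ℂ)) hω hj.symm, hj]
  · simp [hi]

lemma iSup_bidegree (n : ℕ) : ⨆ e : ℕ × ℕ, bidegree n e.1 e.2 = ⊤ := by
  set M := ⨆ e : ℕ × ℕ, bidegree n e.1 e.2
  have le_M (e : ℕ × ℕ) : bidegree n e.1 e.2 ≤ M :=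
    le_iSup (fun e : ℕ × ℕ => bidegree n e.1 e.2) e
  have map_mem (T : Superspace n →ₗ[ℂ] Superspace n)
      (hT : ∀ e : ℕ × ℕ, bidegree n e.1 e.2 ≤ M.comap T) (f) (hf : f ∈ M) : T f ∈ M :=
    iSup_le hT hf
  refine eq_top_iff.mpr fun f _ => ?_
  induction f using superspace_induction with
  | one => exact le_M (0, 0) one_mem_bidegree
  | smul c f h => exact M.smul_mem _ (h trivial)
  | add f g hf hg => exact M.add_mem (hf trivial) (hg trivial)
  | bos_mul v f h =>
    exact map_mem (LinearMap.mulLeft ℂ (bos v))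
      (fun e _ hg => le_M (e.1 + 1, e.2) (bos_mul_mem_bidegree v hg)) f (h trivial)
  | fer_mul v f h =>
    exact map_mem (LinearMap.mulLeft ℂ (fer v))
      (fun e _ hg => le_M (e.1, e.2 + 1) (fer_mul_mem_bidegree v hg)) f (h trivial)

theorem bidegree_induction {P : Superspace n → Prop}
    (add : ∀ f g, P f → P g → P (f + g)) (mem : ∀ i j, ∀ f ∈ bidegree n i j, P f)
    (f : Superspace n) : P f := by
  have hf : f ∈ ⨆ e : ℕ × ℕ, bidegree n e.1 e.2 := by rw [iSup_bidegree]; trivial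
  induction hf using Submodule.iSup_induction' with
  | mem e x hx => exact mem _ _ x hx
  | zero => exact mem 0 0 0 (Submodule.zero_mem _)
  | add x y _ _ hx hy => exact add x y hx hy

lemma dBos_bidegreeProj (f : Superspace n) :
    dBos a (bidegreeProj n (i + 1, j) f) = bidegreeProj n (i, j) (dBos a f) := by
  induction f using bidegree_induction with
  | add f g hf hg => simp only [map_add, hf, hg]
  | mem k l f hf =>
    rw [bidegreeProj_of_mem hf]
    rcases k with _ | k
    · rw [dBos_eq_zero_of_mem_bidegree a hf, if_neg (by simp), map_zero, map_zero]
    · rw [bidegreeProj_of_mem (dBos_mem_bidegree a hf), apply_ite (dBos a), map_zero]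
      simp only [Prod.mk.injEq, Nat.add_right_cancel_iff]

lemma dFer_bidegreeProj (f : Superspace n) :
    dFer a (bidegreeProj n (i, j + 1) f) = bidegreeProj n (i, j) (dFer a f) := by
  induction f using bidegree_induction with
  | add f g hf hg => simp only [map_add, hf, hg]
  | mem k l f hf =>
    rw [bidegreeProj_of_mem hf]
    rcases l with _ | l
    · rw [dFer_eq_zero_of_mem_bidegree a hf, if_neg (by simp), map_zero, map_zero]
    · rw [bidegreeProj_of_mem (dFer_mem_bidegree a hf), apply_ite (dFer a), map_zero]
      simp only [Prod.mk.injEq, Nat.add_right_cancel_iff]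

end

/-! ### Power spaces -/

/-- The number of covectors in `l`, counted with multiplicity, that do not vanish at `v`: the
number `ρ(ℂ v)` for the arrangement of the hyperplanes `ker a`, `a ∈ l`. -/
def covecRho {n : ℕ} (l : Multiset (Module.Dual ℂ (Fin n → ℂ))) (v : Fin n → ℂ) : ℕ :=
  l.countP fun a => a v ≠ 0

/-- The span of the multiples of `λ_v ^ (ρ v + 1)` and `λ_v ^ (ρ v) dλ_v` for `v ∈ C`, where `ρ v`
counts the covectors of `l` that do not vanish at `v`. For `C = ⊤` this is the superspace ideal of
the arrangement `l`; smaller `C` arise from restricting to intersections of hyperplanes. -/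
def superPower {n : ℕ} (l : Multiset (Module.Dual ℂ (Fin n → ℂ))) (C : Submodule ℂ (Fin n → ℂ)) :
    Submodule ℂ (Superspace n) :=
  Submodule.span ℂ {f | ∃ v ∈ C, ∃ g, f = bos v ^ (covecRho l v + 1) * g ∨
    f = bos v ^ covecRho l v * (fer v * g)}

section

variable {n : ℕ} {a : Module.Dual ℂ (Fin n → ℂ)} {l : Multiset (Module.Dual ℂ (Fin n → ℂ))}
  {C D : Submodule ℂ (Fin n → ℂ)} {v : Fin n → ℂ} {f : Superspace n} {k : ℕ}

lemma covecRho_cons_of_eq_zero (h : a v = 0) : covecRho (a ::ₘ l) v = covecRho l v :=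
  Multiset.countP_cons_of_neg _ (not_not.mpr h)

lemma covecRho_cons_of_ne_zero (h : a v ≠ 0) : covecRho (a ::ₘ l) v = covecRho l v + 1 :=
  Multiset.countP_cons_of_pos _ h

lemma covecRho_le_cons : covecRho l v ≤ covecRho (a ::ₘ l) v :=
  Multiset.countP_le_of_le _ (Multiset.le_cons_self l a)

lemma superPower_le {N : Submodule ℂ (Superspace n)}
    (hb : ∀ v ∈ C, ∀ g, bos v ^ (covecRho l v + 1) * g ∈ N)
    (hf : ∀ v ∈ C, ∀ g, bos v ^ covecRho l v * (fer v * g) ∈ N) : superPower l C ≤ N := by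
  refine Submodule.span_le.mpr ?_
  rintro _ ⟨v, hv, g, rfl | rfl⟩
  · exact hb v hv g
  · exact hf v hv g

lemma bos_pow_mul_mem_superPower (hv : v ∈ C) (hk : covecRho l v + 1 ≤ k) (g : Superspace n) :
    bos v ^ k * g ∈ superPower l C := by
  obtain ⟨m, rfl⟩ := Nat.exists_eq_add_of_le hk
  rw [pow_add, mul_assoc]
  exact Submodule.subset_span ⟨v, hv, _, Or.inl rfl⟩

lemma bos_pow_mul_fer_mul_mem_superPower (hv : v ∈ C) (hk : covecRho l v ≤ k)
    (g : Superspace n) : bos v ^ k * (fer v * g) ∈ superPower l C := by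
  obtain ⟨m, rfl⟩ := Nat.exists_eq_add_of_le hk
  rw [pow_add, mul_assoc, bos_pow_mul_comm v _ m, mul_assoc]
  exact Submodule.subset_span ⟨v, hv, _, Or.inr rfl⟩

lemma mul_mem_superPower_right (hf : f ∈ superPower l C) (h : Superspace n) :
    f * h ∈ superPower l C := by
  suffices key : superPower l C ≤ (superPower l C).comap (LinearMap.mulRight ℂ h) from key hf
  refine superPower_le (fun v hv g => ?_) (fun v hv g => ?_)
  · rw [Submodule.mem_comap, LinearMap.mulRight_apply, mul_assoc]
    exact bos_pow_mul_mem_superPower hv le_rfl _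
  · rw [Submodule.mem_comap, LinearMap.mulRight_apply, mul_assoc, mul_assoc]
    exact bos_pow_mul_fer_mul_mem_superPower hv le_rfl _

lemma mul_mem_superPower_left (hf : f ∈ superPower l C) (h : Superspace n) :
    h * f ∈ superPower l C := by
  suffices key : superPower l C ≤ (superPower l C).comap (LinearMap.mulLeft ℂ h) from key hf
  obtain ⟨h', hh⟩ := exists_mul_fer h
  refine superPower_le (fun v hv g => ?_) (fun v hv g => ?_)
  · rw [Submodule.mem_comap, LinearMap.mulLeft_apply, ← mul_assoc, ← bos_pow_mul_comm, mul_assoc]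
    exact bos_pow_mul_mem_superPower hv le_rfl _
  · rw [Submodule.mem_comap, LinearMap.mulLeft_apply, ← mul_assoc, ← bos_pow_mul_comm, mul_assoc,
      ← mul_assoc h, hh, mul_assoc]
    exact bos_pow_mul_fer_mul_mem_superPower hv le_rfl _

lemma superPower_mono (h : C ≤ D) : superPower l C ≤ superPower l D :=
  superPower_le (fun _ hv _ => bos_pow_mul_mem_superPower (h hv) le_rfl _)
    (fun _ hv _ => bos_pow_mul_fer_mul_mem_superPower (h hv) le_rfl _)

lemma superPower_cons_le : superPower (a ::ₘ l) C ≤ superPower l C :=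
  superPower_le
    (fun _ hv _ => bos_pow_mul_mem_superPower hv (Nat.add_le_add_right covecRho_le_cons 1) _)
    (fun _ hv _ => bos_pow_mul_fer_mul_mem_superPower hv covecRho_le_cons _)

lemma superPower_cons_of_le_ker (h : C ≤ LinearMap.ker a) :
    superPower (a ::ₘ l) C = superPower l C :=
  superPower_cons_le.antisymm <| superPower_le
    (fun _ hv _ => bos_pow_mul_mem_superPower hv (by rw [covecRho_cons_of_eq_zero (h hv)]) _)
    (fun _ hv _ =>
      bos_pow_mul_fer_mul_mem_superPower hv (by rw [covecRho_cons_of_eq_zero (h hv)]) _)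

lemma superPower_inf_ker_le_cons : superPower l (C ⊓ LinearMap.ker a) ≤ superPower (a ::ₘ l) C :=
  (superPower_cons_of_le_ker inf_le_right).ge.trans (superPower_mono inf_le_left)

lemma dBos_mem_superPower_of_cons (hf : f ∈ superPower (a ::ₘ l) C) :
    dBos a f ∈ superPower l C := by
  suffices key : superPower (a ::ₘ l) C ≤ (superPower l C).comap (dBos a) from key hf
  refine superPower_le (fun v hv g => ?_) (fun v hv g => ?_) <;> rw [Submodule.mem_comap] <;>
    by_cases h : a v = 0
  · rw [covecRho_cons_of_eq_zero h, dBos_bos_pow_mul_of_eq_zero _ h]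
    exact bos_pow_mul_mem_superPower hv le_rfl _
  · rw [covecRho_cons_of_ne_zero h, dBos_bos_pow_mul]
    exact Submodule.add_mem _ (Submodule.smul_mem _ _ (bos_pow_mul_mem_superPower hv le_rfl _))
      (bos_pow_mul_mem_superPower hv (Nat.le_succ _) _)
  · rw [covecRho_cons_of_eq_zero h, dBos_bos_pow_mul_of_eq_zero _ h, dBos_fer_mul]
    exact bos_pow_mul_fer_mul_mem_superPower hv le_rfl _
  · rw [covecRho_cons_of_ne_zero h, dBos_bos_pow_mul]
    exact Submodule.add_mem _
      (Submodule.smul_mem _ _ (bos_pow_mul_fer_mul_mem_superPower hv le_rfl _))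
      (bos_pow_mul_mem_superPower hv le_rfl _)

lemma dFer_mem_superPower_of_cons (hf : f ∈ superPower (a ::ₘ l) C) :
    dFer a f ∈ superPower l C := by
  suffices key : superPower (a ::ₘ l) C ≤ (superPower l C).comap (dFer a) from key hf
  refine superPower_le (fun v hv g => ?_) (fun v hv g => ?_)
  · rw [Submodule.mem_comap, dFer_bos_pow_mul]
    exact superPower_cons_le (bos_pow_mul_mem_superPower (l := a ::ₘ l) hv le_rfl _)
  · rw [Submodule.mem_comap, dFer_bos_pow_mul, dFer_fer_mul, superspace_mul_sub]
    refine Submodule.sub_mem _ ?_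
      (superPower_cons_le (bos_pow_mul_fer_mul_mem_superPower (l := a ::ₘ l) hv le_rfl _))
    by_cases h : a v = 0
    · rw [h, zero_smul, mul_zero]; exact Submodule.zero_mem _
    · rw [covecRho_cons_of_ne_zero h]
      exact bos_pow_mul_mem_superPower hv le_rfl _

/-- Repeated integration by parts, each step lowering the bosonic degree of `g`. -/
lemma exists_dBos_bos_pow_mul_eq (hv : a v ≠ 0) (k : ℕ) (g : Superspace n) :
    ∃ F, dBos a (bos v ^ (k + 1) * F) = bos v ^ k * g := by
  induction g using bidegree_induction with
  | add f g hf hg =>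
    obtain ⟨F, hF⟩ := hf
    obtain ⟨G, hG⟩ := hg
    exact ⟨F + G, by rw [mul_add, mul_add, map_add, hF, hG]⟩
  | mem i j g hg =>
    have hk (k : ℕ) : ((k + 1 : ℕ) : ℂ) * a v ≠ 0 :=
      mul_ne_zero (Nat.cast_ne_zero.mpr k.succ_ne_zero) hv
    induction i generalizing g k with
    | zero =>
      refine ⟨(((k + 1 : ℕ) : ℂ) * a v)⁻¹ • g, ?_⟩
      rw [dBos_bos_pow_mul, map_smul, dBos_eq_zero_of_mem_bidegree a hg, mul_smul_comm, smul_smul,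
        mul_inv_cancel₀ (hk k), one_smul, smul_zero, mul_zero, add_zero]
    | succ i ih =>
      obtain ⟨F, hF⟩ := ih (k + 1) (dBos a g) (dBos_mem_bidegree a hg)
      refine ⟨(((k + 1 : ℕ) : ℂ) * a v)⁻¹ • (g - bos v * F), ?_⟩
      rw [mul_smul_comm, map_smul, superspace_mul_sub, map_sub, ← mul_assoc _ (bos v),
        ← pow_succ, hF, dBos_bos_pow_mul, add_sub_cancel_right, smul_smul, inv_mul_cancel₀ (hk k),
        one_smul]

lemma dBos_surjective (ha : a ≠ 0) : Function.Surjective (dBos a) := by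
  intro g
  obtain ⟨v, hv⟩ := DFunLike.ne_iff.mp ha
  obtain ⟨F, hF⟩ := exists_dBos_bos_pow_mul_eq hv 0 g
  exact ⟨_, by rw [hF, pow_zero, one_mul]⟩

lemma exists_mem_superPower_cons_dBos_eq (ha : a ≠ 0) (hf : f ∈ superPower l C) :
    ∃ F ∈ superPower (a ::ₘ l) C, dBos a F = f := by
  suffices key : superPower l C ≤ (superPower (a ::ₘ l) C).map (dBos a) from key hf
  refine superPower_le (fun v hv g => ?_) (fun v hv g => ?_) <;> by_cases h : a v = 0
  · obtain ⟨G, hG⟩ := dBos_surjective ha g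
    refine ⟨_, bos_pow_mul_mem_superPower hv le_rfl G, ?_⟩
    rw [covecRho_cons_of_eq_zero h, dBos_bos_pow_mul_of_eq_zero _ h, hG]
  · obtain ⟨F, hF⟩ := exists_dBos_bos_pow_mul_eq h (covecRho l v + 1) g
    exact ⟨_, bos_pow_mul_mem_superPower hv (by rw [covecRho_cons_of_ne_zero h]) F, hF⟩
  · obtain ⟨G, hG⟩ := dBos_surjective ha g
    refine ⟨_, bos_pow_mul_fer_mul_mem_superPower hv le_rfl G, ?_⟩
    rw [covecRho_cons_of_eq_zero h, dBos_bos_pow_mul_of_eq_zero _ h, dBos_fer_mul, hG]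
  · obtain ⟨F, hF⟩ := exists_dBos_bos_pow_mul_eq h (covecRho l v) g
    refine ⟨_, bos_pow_mul_fer_mul_mem_superPower hv (k := covecRho l v + 1)
      (by rw [covecRho_cons_of_ne_zero h]) F, ?_⟩
    rw [bos_pow_mul_comm, mul_assoc, dBos_fer_mul, ← bos_pow_mul_comm, hF, ← mul_assoc,
      ← bos_pow_mul_comm, mul_assoc]

end

section

variable {n : ℕ} {a : Module.Dual ℂ (Fin n → ℂ)} {l : Multiset (Module.Dual ℂ (Fin n → ℂ))}
  {C : Submodule ℂ (Fin n → ℂ)} {v : Fin n → ℂ} {f : Superspace n}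

lemma exists_dBos_pow_eq_zero (a : Module.Dual ℂ (Fin n → ℂ)) (f : Superspace n) :
    ∃ m, (dBos a ^ m) f = 0 := by
  induction f using bidegree_induction with
  | add f g hf hg =>
    obtain ⟨m, hm⟩ := hf
    obtain ⟨k, hk⟩ := hg
    exact ⟨m + k, by rw [map_add, Module.End.pow_map_zero_of_le (Nat.le_add_right m k) hm,
      Module.End.pow_map_zero_of_le (Nat.le_add_left k m) hk, add_zero]⟩
  | mem i j f hf =>
    induction i generalizing f with
    | zero => exact ⟨1, by rw [pow_one, dBos_eq_zero_of_mem_bidegree a hf]⟩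
    | succ i ih =>
      obtain ⟨m, hm⟩ := ih _ (dBos_mem_bidegree a hf)
      exact ⟨m + 1, by rw [pow_succ, Module.End.mul_apply, hm]⟩

lemma dBos_pow_bos_mul (a : Module.Dual ℂ (Fin n → ℂ)) (v : Fin n → ℂ) (m : ℕ)
    (f : Superspace n) :
    (dBos a ^ (m + 1)) (bos v * f) =
      ((m + 1 : ℕ) * a v) • (dBos a ^ m) f + bos v * (dBos a ^ (m + 1)) f := by
  induction m with
  | zero => simp only [zero_add, pow_one, Nat.cast_one, one_mul, pow_zero, dBos_bos_mul,
      Module.End.one_apply]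
  | succ m ih =>
    rw [pow_succ', Module.End.mul_apply, ih, map_add, map_smul, dBos_bos_mul,
      ← Module.End.mul_apply, ← pow_succ', ← Module.End.mul_apply, ← pow_succ', ← add_assoc,
      ← add_smul]
    congr 2
    push_cast
    ring

lemma eq_zero_of_dBos_bos_mul_eq_zero (hv : a v ≠ 0) (h : dBos a (bos v * f) = 0) : f = 0 := by
  obtain ⟨m, hm⟩ := exists_dBos_pow_eq_zero a f
  induction m with
  | zero => simpa only [pow_zero, Module.End.one_apply] using hm
  | succ m ih =>
    refine ih ?_
    have hpow := dBos_pow_bos_mul a v m f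
    rw [hm, mul_zero, add_zero, pow_succ, Module.End.mul_apply, h, map_zero] at hpow
    exact (smul_eq_zero.mp hpow.symm).resolve_left
      (mul_ne_zero (Nat.cast_ne_zero.mpr m.succ_ne_zero) hv)

/-- The algebra endomorphism of `Ωₙ` induced by the linear substitution `λ_v ↦ λ_{p v}`,
`dλ_v ↦ dλ_{p v}`. -/
def substHom (p : (Fin n → ℂ) →ₗ[ℂ] (Fin n → ℂ)) : Superspace n →ₐ[ℂ] Superspace n :=
  Algebra.TensorProduct.map (MvPolynomial.aeval fun i => linearForm (p (Pi.single i 1)))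
    (ExteriorAlgebra.map p)

lemma substHom_bos (p : (Fin n → ℂ) →ₗ[ℂ] (Fin n → ℂ)) (v : Fin n → ℂ) :
    substHom p (bos v) = bos (p v) := by
  have h (i : Fin n) : substHom p (bos (Pi.single i 1)) = bos (p (Pi.single i 1)) := by
    simp [substHom, bos_apply, linearForm_single]
  rw [pi_eq_sum_univ' v]
  simp only [map_sum, map_smul, h]

lemma substHom_fer (p : (Fin n → ℂ) →ₗ[ℂ] (Fin n → ℂ)) (v : Fin n → ℂ) :
    substHom p (fer v) = fer (p v) := by
  simp [substHom, fer_apply, ExteriorAlgebra.map_apply_ι]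

/-- The projection onto `ker a` along `v`, for `a v = 1`. -/
def projKer (a : Module.Dual ℂ (Fin n → ℂ)) (v : Fin n → ℂ) : (Fin n → ℂ) →ₗ[ℂ] (Fin n → ℂ) :=
  LinearMap.id - a.smulRight v

lemma projKer_apply (w : Fin n → ℂ) : projKer a v w = w - a w • v := rfl

lemma projKer_mem_inf_ker (hv : a v = 1) (hvC : v ∈ C) {w : Fin n → ℂ} (hw : w ∈ C) :
    projKer a v w ∈ C ⊓ LinearMap.ker a :=
  ⟨C.sub_mem hw (C.smul_mem _ hvC), by
    rw [SetLike.mem_coe, LinearMap.mem_ker, projKer_apply, map_sub, map_smul, hv, smul_eq_mul,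
      mul_one, sub_self]⟩

lemma dBos_substHom_projKer (hv : a v = 1) (f : Superspace n) :
    dBos a (substHom (projKer a v) f) = 0 := by
  have hker (w : Fin n → ℂ) : a (projKer a v w) = 0 :=
    (projKer_mem_inf_ker (C := ⊤) hv trivial trivial).2
  induction f using superspace_induction with
  | one => rw [map_one, dBos_one]
  | smul c f hf => rw [map_smul, map_smul, hf, smul_zero]
  | add f g hf hg => rw [map_add, map_add, hf, hg, add_zero]
  | bos_mul w f hf =>
    rw [map_mul, substHom_bos, dBos_bos_mul, hker, hf, zero_smul, mul_zero, add_zero]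
  | fer_mul w f hf => rw [map_mul, substHom_fer, dBos_fer_mul, hf, mul_zero]

lemma bos_mul_eq_substHom_projKer_add {g : Superspace n}
    (hg : f = substHom (projKer a v) f + bos v * g + fer v * dFer a f) (w : Fin n → ℂ) :
    bos w * f = substHom (projKer a v) (bos w * f) +
      bos v * (a w • substHom (projKer a v) f + bos w * g) + fer v * dFer a (bos w * f) := by
  have hw : bos w = bos (projKer a v w) + a w • bos v := by
    rw [projKer_apply, map_sub, map_smul, sub_add_cancel]
  calc bos w * f
      = bos w * substHom (projKer a v) f + bos w * (bos v * g) + bos w * (fer v * dFer a f) := by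
        rw [← mul_add, ← mul_add, ← hg]
    _ = bos w * substHom (projKer a v) f + bos v * (bos w * g) + fer v * (bos w * dFer a f) := by
        simp only [← mul_assoc, bos_mul_comm w (bos v), bos_mul_comm w (fer v)]
    _ = _ := by
        rw [dFer_bos_mul, map_mul, substHom_bos, mul_add, ← add_assoc, mul_smul_comm,
          ← smul_mul_assoc, ← add_mul, ← hw]

lemma fer_mul_eq_substHom_projKer_add {g : Superspace n}
    (hg : f = substHom (projKer a v) f + bos v * g + fer v * dFer a f) (w : Fin n → ℂ) :
    fer w * f = substHom (projKer a v) (fer w * f) + bos v * (fer (projKer a v w) * g) +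
      fer v * dFer a (fer w * f) := by
  have hw : fer w = fer (projKer a v w) + a w • fer v := by
    rw [projKer_apply, map_sub, map_smul, sub_add_cancel]
  have hanti : fer v * fer w = -(fer (projKer a v w) * fer v) := by
    rw [fer_mul_fer v w, hw, add_mul, smul_mul_assoc, fer_mul_self, smul_zero, add_zero]
  calc fer w * f
      = fer (projKer a v w) * f + a w • (fer v * f) := by rw [hw, add_mul, smul_mul_assoc]
    _ = fer (projKer a v w) * (substHom (projKer a v) f + bos v * g + fer v * dFer a f) +
          a w • (fer v * f) := by rw [← hg]
    _ = _ := by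
        rw [dFer_fer_mul, map_mul, substHom_fer, superspace_mul_sub, ← mul_assoc (fer v) (fer w),
          hanti, superspace_neg_mul, mul_smul_comm, mul_add, mul_add, ← mul_assoc _ (bos v),
          ← bos_mul_comm, mul_assoc, mul_assoc]
        abel

lemma exists_eq_substHom_projKer_add (a : Module.Dual ℂ (Fin n → ℂ)) (v : Fin n → ℂ)
    (f : Superspace n) :
    ∃ g, f = substHom (projKer a v) f + bos v * g + fer v * dFer a f := by
  induction f using superspace_induction with
  | one => exact ⟨0, by rw [dFer_one, map_one, mul_zero, mul_zero, add_zero, add_zero]⟩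
  | smul c f hf =>
    obtain ⟨g, hg⟩ := hf
    exact ⟨c • g, by
      rw [map_smul, map_smul, mul_smul_comm, mul_smul_comm, ← smul_add, ← smul_add, ← hg]⟩
  | add f₁ f₂ h₁ h₂ =>
    obtain ⟨g₁, hg₁⟩ := h₁
    obtain ⟨g₂, hg₂⟩ := h₂
    refine ⟨g₁ + g₂, ?_⟩
    rw [map_add, map_add, mul_add, mul_add]
    nth_rw 1 [hg₁, hg₂]
    abel
  | bos_mul w f hf =>
    obtain ⟨g, hg⟩ := hf
    exact ⟨_, bos_mul_eq_substHom_projKer_add hg w⟩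
  | fer_mul w f hf =>
    obtain ⟨g, hg⟩ := hf
    exact ⟨_, fer_mul_eq_substHom_projKer_add hg w⟩

lemma eq_substHom_projKer_add_of_dBos_eq_zero (hv : a v = 1) (h : dBos a f = 0) :
    f = substHom (projKer a v) f + fer v * dFer a f := by
  obtain ⟨g, hg⟩ := exists_eq_substHom_projKer_add a v f
  have hg₀ : dBos a (bos v * g) = 0 := by
    have := congrArg (dBos a) hg
    rwa [map_add, map_add, dBos_substHom_projKer hv, dBos_fer_mul, dBos_dFer, h, map_zero,
      mul_zero, zero_add, add_zero, eq_comm] at this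
  rwa [eq_zero_of_dBos_bos_mul_eq_zero (hv.trans_ne one_ne_zero) hg₀, mul_zero, add_zero] at hg

lemma substHom_projKer_mem_superPower_zero (hv : a v = 1) (hvC : v ∈ C)
    (hf : f ∈ superPower 0 C) :
    substHom (projKer a v) f ∈ superPower 0 (C ⊓ LinearMap.ker a) := by
  suffices key : superPower 0 C ≤
      (superPower 0 (C ⊓ LinearMap.ker a)).comap (substHom (projKer a v)).toLinearMap from key hf
  refine superPower_le (fun w hw g => ?_) (fun w hw g => ?_) <;>
    rw [Submodule.mem_comap, AlgHom.toLinearMap_apply, map_mul, map_pow, substHom_bos]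
  · exact bos_pow_mul_mem_superPower (projKer_mem_inf_ker hv hvC hw) le_rfl _
  · rw [map_mul, substHom_fer]
    exact bos_pow_mul_fer_mul_mem_superPower (projKer_mem_inf_ker hv hvC hw) le_rfl _

lemma exists_mem_apply_eq_one (hC : ¬ C ≤ LinearMap.ker a) : ∃ v ∈ C, a v = 1 := by
  obtain ⟨u, huC, hu⟩ := SetLike.not_le_iff_exists.mp hC
  exact ⟨(a u)⁻¹ • u, C.smul_mem _ huC, by rw [map_smul, smul_eq_mul, inv_mul_cancel₀ hu]⟩

lemma mem_superPower_zero_inf_ker (hf : f ∈ superPower 0 C) (hB : dBos a f = 0)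
    (hF : dFer a f ∈ superPower 0 C) : f ∈ superPower 0 (C ⊓ LinearMap.ker a) := by
  by_cases hC : C ≤ LinearMap.ker a
  · rwa [inf_eq_left.mpr hC]
  obtain ⟨v, hvC, hv⟩ := exists_mem_apply_eq_one hC
  have hF' : dFer a f ∈ superPower 0 (C ⊓ LinearMap.ker a) := by
    have hB' : dBos a (dFer a f) = 0 := by rw [dBos_dFer, hB, map_zero]
    rw [eq_substHom_projKer_add_of_dBos_eq_zero hv hB', dFer_self, mul_zero, add_zero]
    exact substHom_projKer_mem_superPower_zero hv hvC hF
  rw [eq_substHom_projKer_add_of_dBos_eq_zero hv hB]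
  exact Submodule.add_mem _ (substHom_projKer_mem_superPower_zero hv hvC hf)
    (mul_mem_superPower_left hF' _)

lemma mem_superPower_cons_of_inf_ker
    (h : ∀ f ∈ superPower l C, dBos a f = 0 → dFer a f ∈ superPower l C →
      f ∈ superPower l (C ⊓ LinearMap.ker a))
    (hf : f ∈ superPower l C) (hB : dBos a f ∈ superPower l C) (hF : dFer a f ∈ superPower l C) :
    f ∈ superPower (a ::ₘ l) C := by
  rcases eq_or_ne a 0 with rfl | ha
  · rwa [superPower_cons_of_le_ker (by rw [LinearMap.ker_zero]; exact le_top)]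
  obtain ⟨F, hFmem, hFB⟩ := exists_mem_superPower_cons_dBos_eq ha hB
  have hdiff : f - F ∈ superPower l (C ⊓ LinearMap.ker a) :=
    h _ (Submodule.sub_mem _ hf (superPower_cons_le hFmem)) (by rw [map_sub, hFB, sub_self])
      (by rw [map_sub]; exact Submodule.sub_mem _ hF (dFer_mem_superPower_of_cons hFmem))
  rw [← sub_add_cancel f F]
  exact Submodule.add_mem _ (superPower_inf_ker_le_cons hdiff) hFmem

theorem mem_superPower_inf_ker (hf : f ∈ superPower l C) (hB : dBos a f = 0)
    (hF : dFer a f ∈ superPower l C) : f ∈ superPower l (C ⊓ LinearMap.ker a) := by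
  induction l using Multiset.induction generalizing a f C with
  | empty => exact mem_superPower_zero_inf_ker hf hB hF
  | cons b l ih =>
    refine mem_superPower_cons_of_inf_ker (fun g => ih) ?_ ?_ ?_
    · exact ih (superPower_cons_le hf) hB (superPower_cons_le hF)
    · refine ih (dBos_mem_superPower_of_cons hf) ?_ ?_
      · rw [dBos_comm, hB, map_zero]
      · rw [← dBos_dFer]
        exact dBos_mem_superPower_of_cons hF
    · refine ih (dFer_mem_superPower_of_cons hf) ?_ ?_
      · rw [dBos_dFer, hB, map_zero]
      · rw [dFer_dFer]
        exact Submodule.neg_mem _ (dFer_mem_superPower_of_cons hF)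

theorem superPower_cons_inf_ker_dBos :
    superPower (a ::ₘ l) C ⊓ LinearMap.ker (dBos a) =
      superPower l (C ⊓ LinearMap.ker a) ⊓ LinearMap.ker (dBos a) := by
  refine le_antisymm (fun f hf => ⟨?_, hf.2⟩) (inf_le_inf_right _ superPower_inf_ker_le_cons)
  exact mem_superPower_inf_ker (superPower_cons_le hf.1) hf.2 (dFer_mem_superPower_of_cons hf.1)

end

/-! ### Hilbert series -/

/-- A subspace of `Ωₙ` is graded if it contains the bihomogeneous components of its elements. -/
def IsGraded {n : ℕ} (M : Submodule ℂ (Superspace n)) : Prop :=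
  ∀ f ∈ M, ∀ e, bidegreeProj n e f ∈ M

/-- The Hilbert series of a graded subspace of `Ωₙ`. -/
def hilb {n : ℕ} (M : Submodule ℂ (Superspace n)) : MvPowerSeries (Fin 2) ℤ :=
  fun e => (Module.finrank ℂ ↥(M ⊓ bidegree n (e 0) (e 1)) : ℤ)

/-- `T` lowers the bosonic (`k = 0`) or the fermionic (`k = 1`) degree by one. -/
structure LowersDegree {n : ℕ} (k : Fin 2) (T : Superspace n →ₗ[ℂ] Superspace n) : Prop where
  bidegree_le_ker : ∀ e : Fin 2 →₀ ℕ, e k = 0 → bidegree n (e 0) (e 1) ≤ LinearMap.ker T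
  apply_bidegreeProj : ∀ e e' : Fin 2 →₀ ℕ, e' = e + Finsupp.single k 1 → ∀ f,
    T (bidegreeProj n (e' 0, e' 1) f) = bidegreeProj n (e 0, e 1) (T f)

section

variable {n : ℕ} {M : Submodule ℂ (Superspace n)} {k : Fin 2}
  {T : Superspace n →ₗ[ℂ] Superspace n}

lemma bidegreeProj_mem (e : ℕ × ℕ) (f : Superspace n) :
    bidegreeProj n e f ∈ bidegree n e.1 e.2 := by
  induction f using bidegree_induction with
  | add f g hf hg => rw [map_add]; exact Submodule.add_mem _ hf hg
  | mem i j f hf =>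
    rw [bidegreeProj_of_mem hf]
    split_ifs with h
    · rwa [h]
    · exact Submodule.zero_mem _

lemma lowersDegree_dBos (a : Module.Dual ℂ (Fin n → ℂ)) : LowersDegree 0 (dBos a) where
  bidegree_le_ker e he f hf := by
    rw [he] at hf
    exact dBos_eq_zero_of_mem_bidegree a hf
  apply_bidegreeProj e e' h f := by
    have h0 : e' 0 = e 0 + 1 := by simp [h]
    have h1 : e' 1 = e 1 := by simp [h]
    rw [h0, h1, dBos_bidegreeProj]

lemma lowersDegree_dFer (a : Module.Dual ℂ (Fin n → ℂ)) : LowersDegree 1 (dFer a) where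
  bidegree_le_ker e he f hf := by
    rw [he] at hf
    exact dFer_eq_zero_of_mem_bidegree a hf
  apply_bidegreeProj e e' h f := by
    have h0 : e' 0 = e 0 := by simp [h]
    have h1 : e' 1 = e 1 + 1 := by simp [h]
    rw [h0, h1, dFer_bidegreeProj]

lemma isGraded_top : IsGraded (⊤ : Submodule ℂ (Superspace n)) := fun _ _ _ => trivial

lemma isGraded_superPower (l : Multiset (Module.Dual ℂ (Fin n → ℂ)))
    (C : Submodule ℂ (Fin n → ℂ)) : IsGraded (superPower l C) := by
  intro f hf e
  suffices key : superPower l C ≤ (superPower l C).comap (bidegreeProj n e) from key hf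
  refine superPower_le (fun v hv g => ?_) (fun v hv g => ?_) <;>
    induction g using bidegree_induction with
    | add f g hf hg => simp only [mul_add]; exact Submodule.add_mem _ hf hg
    | mem i j g hg => ?_
  · rw [Submodule.mem_comap, bidegreeProj_of_mem (bos_pow_mul_mem_bidegree v _ hg)]
    split_ifs
    · exact bos_pow_mul_mem_superPower hv le_rfl _
    · exact Submodule.zero_mem _
  · rw [Submodule.mem_comap,
      bidegreeProj_of_mem (bos_pow_mul_mem_bidegree v _ (fer_mul_mem_bidegree v hg))]
    split_ifs
    · exact bos_pow_mul_fer_mul_mem_superPower hv le_rfl _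
    · exact Submodule.zero_mem _

lemma exists_eq_add_single {e : Fin 2 →₀ ℕ} (h : e k ≠ 0) :
    ∃ e', e = e' + Finsupp.single k 1 :=
  ⟨e - Finsupp.single k 1, (tsub_add_cancel_of_le <| Finsupp.single_le_iff.mpr <|
    Nat.one_le_iff_ne_zero.mpr h).symm⟩

namespace LowersDegree

lemma isGraded_inf_ker (hT : LowersDegree k T) (hM : IsGraded M) :
    IsGraded (M ⊓ LinearMap.ker T) := by
  rintro f ⟨hf, hTf⟩ ⟨i, j⟩
  refine ⟨hM f hf _, ?_⟩
  obtain ⟨e, rfl, rfl⟩ : ∃ e : Fin 2 →₀ ℕ, e 0 = i ∧ e 1 = j :=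
    ⟨Finsupp.equivFunOnFinite.symm ![i, j], rfl, rfl⟩
  by_cases he : e k = 0
  · exact hT.bidegree_le_ker e he (bidegreeProj_mem (e 0, e 1) f)
  · obtain ⟨e', h⟩ := exists_eq_add_single he
    rw [SetLike.mem_coe, LinearMap.mem_ker, hT.apply_bidegreeProj e' e h, LinearMap.mem_ker.mp hTf,
      map_zero]

lemma map_inf_bidegree (hT : LowersDegree k T) (hM : IsGraded M) {e e' : Fin 2 →₀ ℕ}
    (h : e' = e + Finsupp.single k 1) :
    (M ⊓ bidegree n (e' 0) (e' 1)).map T = M.map T ⊓ bidegree n (e 0) (e 1) := by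
  refine le_antisymm ?_ ?_
  · rintro _ ⟨f, ⟨hfM, hf⟩, rfl⟩
    refine ⟨Submodule.mem_map_of_mem hfM, ?_⟩
    have hproj := hT.apply_bidegreeProj e e' h f
    rw [bidegreeProj_of_mem hf, if_pos rfl] at hproj
    rw [hproj]
    exact bidegreeProj_mem (e 0, e 1) _
  · rintro _ ⟨⟨f, hfM, rfl⟩, hf⟩
    refine ⟨_, ⟨hM f hfM _, bidegreeProj_mem (e' 0, e' 1) f⟩, ?_⟩
    rw [hT.apply_bidegreeProj e e' h, bidegreeProj_of_mem hf, if_pos rfl]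

end LowersDegree

lemma finrank_map_add_finrank_inf_ker {V W : Type*} [AddCommGroup V] [Module ℂ V]
    [AddCommGroup W] [Module ℂ W] (T : V →ₗ[ℂ] W) (P : Submodule ℂ V) [Module.Finite ℂ P] :
    Module.finrank ℂ ↥(P.map T) + Module.finrank ℂ ↥(P ⊓ LinearMap.ker T) =
      Module.finrank ℂ P := by
  have h : (LinearMap.ker (T.domRestrict P)).map P.subtype = P ⊓ LinearMap.ker T := by
    rw [LinearMap.ker_domRestrict, Submodule.map_comap_subtype]
  rw [← LinearMap.finrank_range_add_finrank_ker (T.domRestrict P), LinearMap.range_domRestrict,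
    ← Submodule.finrank_map_subtype_eq P (LinearMap.ker (T.domRestrict P)), h]

lemma finite_inf_bidegree (M : Submodule ℂ (Superspace n)) (i j : ℕ) :
    Module.Finite ℂ ↥(M ⊓ bidegree n i j) :=
  Submodule.finiteDimensional_of_le inf_le_right

lemma coeff_hilb (M : Submodule ℂ (Superspace n)) (e : Fin 2 →₀ ℕ) :
    MvPowerSeries.coeff e (hilb M) = Module.finrank ℂ ↥(M ⊓ bidegree n (e 0) (e 1)) :=
  rfl

theorem LowersDegree.hilb_eq (hT : LowersDegree k T) (hM : IsGraded M) :
    hilb M = MvPowerSeries.X k * hilb (M.map T) + hilb (M ⊓ LinearMap.ker T) := by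
  ext e
  rw [map_add]
  by_cases he : e k = 0
  · rw [MvPowerSeries.X, MvPowerSeries.coeff_monomial_mul,
      if_neg fun h => by simpa [he] using h k, zero_add, coeff_hilb, coeff_hilb, inf_assoc,
      inf_eq_right.mpr (hT.bidegree_le_ker e he)]
  · obtain ⟨e', h⟩ := exists_eq_add_single he
    have := finite_inf_bidegree M (e 0) (e 1)
    have hX : MvPowerSeries.coeff e (MvPowerSeries.X k * hilb (M.map T)) =
        MvPowerSeries.coeff e' (hilb (M.map T)) := by
      rw [h, add_comm, MvPowerSeries.X, MvPowerSeries.coeff_add_monomial_mul, one_mul]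
    rw [hX, coeff_hilb, coeff_hilb, coeff_hilb, inf_right_comm, ← hT.map_inf_bidegree hM h,
      ← finrank_map_add_finrank_inf_ker T, Nat.cast_add]

end

/-- The bigraded Hilbert series of the quotient of `Ωₙ` by `superPower l C`. -/
def quotHilb {n : ℕ} (l : Multiset (Module.Dual ℂ (Fin n → ℂ)))
    (C : Submodule ℂ (Fin n → ℂ)) : MvPowerSeries (Fin 2) ℤ :=
  hilb (n := n) ⊤ - hilb (superPower l C)

/-- The elements of `Ωₙ` in which the direction dual to `a` occurs neither as a bosonic nor as a
fermionic variable. -/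
def constants {n : ℕ} (a : Module.Dual ℂ (Fin n → ℂ)) : Submodule ℂ (Superspace n) :=
  LinearMap.ker (dBos a) ⊓ LinearMap.ker (dFer a)

section

variable {n : ℕ} {M N : Submodule ℂ (Superspace n)} {a : Module.Dual ℂ (Fin n → ℂ)}
  {v : Fin n → ℂ} {l : Multiset (Module.Dual ℂ (Fin n → ℂ))} {C : Submodule ℂ (Fin n → ℂ)}

lemma coeff_quotHilb_nonneg (l : Multiset (Module.Dual ℂ (Fin n → ℂ)))
    (C : Submodule ℂ (Fin n → ℂ)) (e : Fin 2 →₀ ℕ) :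
    0 ≤ MvPowerSeries.coeff e (quotHilb l C) := by
  rw [quotHilb, map_sub, coeff_hilb, coeff_hilb, sub_nonneg, top_inf_eq]
  exact_mod_cast Submodule.finrank_mono inf_le_right

lemma map_dBos_top (ha : a ≠ 0) : (⊤ : Submodule ℂ (Superspace n)).map (dBos a) = ⊤ := by
  rw [Submodule.map_top, LinearMap.range_eq_top.mpr (dBos_surjective ha)]

lemma map_dBos_superPower_cons (ha : a ≠ 0) :
    (superPower (a ::ₘ l) C).map (dBos a) = superPower l C :=
  le_antisymm (Submodule.map_le_iff_le_comap.mpr fun _ => dBos_mem_superPower_of_cons)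
    fun _ => exists_mem_superPower_cons_dBos_eq ha

lemma map_dBos_superPower_inf_ker (ha : a ≠ 0) :
    (superPower l (C ⊓ LinearMap.ker a)).map (dBos a) = superPower l (C ⊓ LinearMap.ker a) := by
  nth_rw 1 [← superPower_cons_of_le_ker (inf_le_right : C ⊓ LinearMap.ker a ≤ LinearMap.ker a)]
  exact map_dBos_superPower_cons ha

theorem quotHilb_cons (a : Module.Dual ℂ (Fin n → ℂ))
    (l : Multiset (Module.Dual ℂ (Fin n → ℂ))) (C : Submodule ℂ (Fin n → ℂ)) :
    quotHilb (a ::ₘ l) C = MvPowerSeries.X 0 * quotHilb l C +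
      (1 - MvPowerSeries.X 0) * quotHilb l (C ⊓ LinearMap.ker a) := by
  by_cases hC : C ≤ LinearMap.ker a
  · rw [quotHilb, superPower_cons_of_le_ker hC, inf_eq_left.mpr hC, quotHilb]
    ring
  have ha : a ≠ 0 := by rintro rfl; exact hC (by rw [LinearMap.ker_zero]; exact le_top)
  have hcons := (lowersDegree_dBos a).hilb_eq (isGraded_superPower (a ::ₘ l) C)
  have hinf := (lowersDegree_dBos a).hilb_eq (isGraded_superPower l (C ⊓ LinearMap.ker a))
  rw [map_dBos_superPower_cons ha, superPower_cons_inf_ker_dBos] at hcons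
  rw [map_dBos_superPower_inf_ker ha] at hinf
  rw [quotHilb, quotHilb, quotHilb]
  linear_combination hinf - hcons

lemma map_dFer_inf_ker_dBos (hv : a v = 1) (hF : ∀ f ∈ M, dFer a f ∈ N)
    (hmul : ∀ f ∈ N, fer v * f ∈ M) :
    (M ⊓ LinearMap.ker (dBos a)).map (dFer a) = N ⊓ constants a := by
  refine le_antisymm ?_ ?_
  · rintro _ ⟨f, ⟨hfM, hf⟩, rfl⟩
    refine ⟨hF f hfM, ?_, dFer_self a f⟩
    rw [SetLike.mem_coe, LinearMap.mem_ker, dBos_dFer, LinearMap.mem_ker.mp hf, map_zero]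
  · rintro f ⟨hfN, hfB, hfF⟩
    refine ⟨fer v * f, ⟨hmul f hfN, ?_⟩, ?_⟩
    · rw [SetLike.mem_coe, LinearMap.mem_ker, dBos_fer_mul, LinearMap.mem_ker.mp hfB, mul_zero]
    · rw [dFer_fer_mul, LinearMap.mem_ker.mp hfF, hv, one_smul, mul_zero, sub_zero]

lemma hilb_eq_of_map_dBos (hM : IsGraded M) (hB : M.map (dBos a) = N) (hv : a v = 1)
    {N' : Submodule ℂ (Superspace n)} (hF : ∀ f ∈ M, dFer a f ∈ N')
    (hmul : ∀ f ∈ N', fer v * f ∈ M) :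
    hilb M = MvPowerSeries.X 0 * hilb N +
      (MvPowerSeries.X 1 * hilb (N' ⊓ constants a) + hilb (M ⊓ constants a)) := by
  rw [(lowersDegree_dBos a).hilb_eq hM, hB, (lowersDegree_dFer a).hilb_eq
    ((lowersDegree_dBos a).isGraded_inf_ker hM), map_dFer_inf_ker_dBos hv hF hmul, inf_assoc]
  rfl

lemma fer_mul_mem_superPower_zero (hv : v ∈ C) (f : Superspace n) :
    fer v * f ∈ superPower 0 C := by
  have h := bos_pow_mul_fer_mul_mem_superPower (l := 0) hv (Multiset.countP_zero _).le f
  rwa [pow_zero, one_mul] at h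

lemma bos_mul_mem_superPower_zero (hv : v ∈ C) (f : Superspace n) :
    bos v * f ∈ superPower 0 C := by
  have h := bos_pow_mul_mem_superPower (l := 0) hv (k := 1)
    (congrArg (· + 1) (Multiset.countP_zero _)).le f
  rwa [pow_one] at h

lemma map_dBos_superPower_zero (hv : v ∈ C) (hav : a v = 1) :
    (superPower 0 C).map (dBos a) = ⊤ := by
  refine eq_top_iff.mpr fun g _ => ?_
  obtain ⟨F, hF⟩ := exists_dBos_bos_pow_mul_eq (by rw [hav]; exact one_ne_zero) 0 g
  rw [zero_add, pow_one, pow_zero, one_mul] at hF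
  exact ⟨_, bos_mul_mem_superPower_zero hv F, hF⟩

lemma superPower_zero_inf_constants :
    superPower 0 C ⊓ constants a = superPower 0 (C ⊓ LinearMap.ker a) ⊓ constants a := by
  refine le_antisymm ?_ (inf_le_inf_right _ (superPower_mono inf_le_left))
  rintro f ⟨hf, hB, hF⟩
  refine ⟨mem_superPower_inf_ker hf hB ?_, hB, hF⟩
  rw [LinearMap.mem_ker.mp hF]
  exact Submodule.zero_mem _

/-- Passing to a hyperplane of `C` frees one bosonic and one fermionic variable. -/
theorem quotHilb_zero_inf_ker (hC : ¬ C ≤ LinearMap.ker a) :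
    (1 - MvPowerSeries.X 0) * quotHilb 0 (C ⊓ LinearMap.ker a) =
      (1 + MvPowerSeries.X 1) * quotHilb 0 C := by
  obtain ⟨v, hvC, hv⟩ := exists_mem_apply_eq_one hC
  have ha : a ≠ 0 := by rintro rfl; exact zero_ne_one hv
  have htop := hilb_eq_of_map_dBos isGraded_top (map_dBos_top ha) hv
    (fun _ _ => Submodule.mem_top) fun _ _ => Submodule.mem_top
  have hinf := hilb_eq_of_map_dBos (isGraded_superPower 0 (C ⊓ LinearMap.ker a))
    (map_dBos_superPower_inf_ker ha) hv
    (fun _ hf => dFer_mem_superPower_of_cons (by rwa [superPower_cons_of_le_ker inf_le_right]))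
    fun _ hf => mul_mem_superPower_left hf _
  have hC' := hilb_eq_of_map_dBos (isGraded_superPower 0 C) (map_dBos_superPower_zero hvC hv) hv
    (fun _ _ => Submodule.mem_top) fun _ _ => fer_mul_mem_superPower_zero hvC _
  rw [superPower_zero_inf_constants] at hC'
  rw [quotHilb, quotHilb]
  linear_combination htop - hinf - (1 + MvPowerSeries.X 1) * (htop - hC')

lemma superPower_zero_top_le_ker :
    superPower 0 (⊤ : Submodule ℂ (Fin n → ℂ)) ≤ LinearMap.ker (bidegreeProj n (0, 0)) := by
  refine superPower_le (fun v _ g => ?_) (fun v _ g => ?_) <;>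
    rw [covecRho, Multiset.countP_zero] <;>
    induction g using bidegree_induction with
    | add f g hf hg => simp only [mul_add]; exact Submodule.add_mem _ hf hg
    | mem i j g hg => ?_
  · rw [LinearMap.mem_ker, bidegreeProj_of_mem (bos_pow_mul_mem_bidegree v _ hg), if_neg (by simp)]
  · rw [LinearMap.mem_ker, pow_zero, one_mul, bidegreeProj_of_mem (fer_mul_mem_bidegree v hg),
      if_neg (by simp)]

lemma sub_bidegreeProj_mem_superPower_zero (f : Superspace n) :
    f - bidegreeProj n (0, 0) f ∈ superPower 0 (⊤ : Submodule ℂ (Fin n → ℂ)) := by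
  have sub_mem {f : Superspace n} (hf : f ∈ superPower 0 (⊤ : Submodule ℂ (Fin n → ℂ))) :
      f - bidegreeProj n (0, 0) f ∈ superPower 0 (⊤ : Submodule ℂ (Fin n → ℂ)) := by
    rwa [LinearMap.mem_ker.mp (superPower_zero_top_le_ker hf), sub_zero]
  induction f using superspace_induction with
  | one =>
    rw [bidegreeProj_of_mem one_mem_bidegree, if_pos rfl, sub_self]
    exact Submodule.zero_mem _
  | smul c f h => rw [map_smul, ← smul_sub c f]; exact Submodule.smul_mem _ c h
  | add f g hf hg => rw [map_add, add_sub_add_comm]; exact Submodule.add_mem _ hf hg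
  | bos_mul v f _ => exact sub_mem (bos_mul_mem_superPower_zero Submodule.mem_top f)
  | fer_mul v f _ => exact sub_mem (fer_mul_mem_superPower_zero Submodule.mem_top f)

theorem quotHilb_zero_top : quotHilb 0 (⊤ : Submodule ℂ (Fin n → ℂ)) = 1 := by
  classical
  ext e
  rw [quotHilb, map_sub, coeff_hilb, coeff_hilb, top_inf_eq, MvPowerSeries.coeff_one]
  split_ifs with he
  · have hbot : superPower 0 (⊤ : Submodule ℂ (Fin n → ℂ)) ⊓ bidegree n 0 0 = ⊥ := by
      refine eq_bot_iff.mpr fun f ⟨hf, hf'⟩ => ?_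
      have h := LinearMap.mem_ker.mp (superPower_zero_top_le_ker hf)
      rwa [bidegreeProj_of_mem hf', if_pos rfl] at h
    rw [he, Finsupp.zero_apply, Finsupp.zero_apply, hbot, bidegree_zero_zero,
      finrank_span_singleton one_ne_zero, finrank_bot]
    rfl
  · have hle : bidegree n (e 0) (e 1) ≤ superPower 0 (⊤ : Submodule ℂ (Fin n → ℂ)) := by
      intro f hf
      have hne : (0, 0) ≠ (e 0, e 1) := fun h => he <| by
        ext k
        fin_cases k
        exacts [(congrArg Prod.fst h).symm, (congrArg Prod.snd h).symm]
      have h := sub_bidegreeProj_mem_superPower_zero f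
      rwa [bidegreeProj_of_mem hf, if_neg hne, sub_zero] at h
    rw [inf_eq_right.mpr hle, sub_self]

end

section

variable {n : ℕ} {a : Module.Dual ℂ (Fin n → ℂ)}
  {C : Submodule ℂ (Fin n → ℂ)}

lemma finrank_inf_ker_add_one (hC : ¬ C ≤ LinearMap.ker a) :
    Module.finrank ℂ ↥(C ⊓ LinearMap.ker a) + 1 = Module.finrank ℂ C := by
  obtain ⟨v, hvC, hv⟩ := exists_mem_apply_eq_one hC
  have hmap : C.map a = ⊤ := eq_top_iff.mpr fun c _ =>
    ⟨c • v, C.smul_mem _ hvC, by rw [map_smul, hv, smul_eq_mul, mul_one]⟩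
  rw [← finrank_map_add_finrank_inf_ker a C, hmap, finrank_top, Module.finrank_self, add_comm]

lemma codim_inf_ker (hC : ¬ C ≤ LinearMap.ker a) :
    n - Module.finrank ℂ ↥(C ⊓ LinearMap.ker a) = n - Module.finrank ℂ C + 1 := by
  have hr := finrank_inf_ker_add_one hC
  have hle := C.finrank_le
  rw [Module.finrank_fin_fun] at hle
  omega

lemma exists_inf_ker_eq (hC : C ≠ ⊤) :
    ∃ D > C, ∃ a : Module.Dual ℂ (Fin n → ℂ), ¬ D ≤ LinearMap.ker a ∧ D ⊓ LinearMap.ker a = C := by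
  obtain ⟨v, -, hv⟩ := SetLike.not_le_iff_exists.mp (mt top_le_iff.mp hC)
  obtain ⟨a, hav, haC⟩ := Submodule.exists_le_ker_of_notMem hv
  have hvD : v ∈ C ⊔ Submodule.span ℂ {v} :=
    Submodule.mem_sup_right (Submodule.mem_span_singleton_self v)
  refine ⟨C ⊔ Submodule.span ℂ {v}, ?_, a, fun h => hav (h hvD), ?_⟩
  · exact lt_of_le_of_ne le_sup_left fun h => hv (h ▸ hvD)
  · rw [sup_inf_assoc_of_le _ haC,
      (Submodule.disjoint_span_singleton_of_notMem hav).symm.eq_bot, sup_bot_eq]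

end

/-! ### Specializations -/

lemma hasSubst_sq : MvPowerSeries.HasSubst ![(PowerSeries.X : PowerSeries ℤ) ^ 2, PowerSeries.X] :=
  MvPowerSeries.hasSubst_of_constantCoeff_zero <| Fin.forall_fin_two.mpr
    ⟨(map_pow _ _ _).trans (by rw [PowerSeries.X, MvPowerSeries.constantCoeff_X, sq, mul_zero]),
      MvPowerSeries.constantCoeff_X _⟩

lemma hasSubst_zero : MvPowerSeries.HasSubst ![(PowerSeries.X : PowerSeries ℤ), 0] :=
  MvPowerSeries.hasSubst_of_constantCoeff_zero <| Fin.forall_fin_two.mpr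
    ⟨MvPowerSeries.constantCoeff_X _, map_zero _⟩

/-- The specialization `(q, t) ↦ (q², q)`. -/
def specSq : MvPowerSeries (Fin 2) ℤ →+* PowerSeries ℤ :=
  (MvPowerSeries.substAlgHom (R := ℤ) hasSubst_sq).toRingHom

/-- The specialization `(q, t) ↦ (q, 0)`. -/
def specZero : MvPowerSeries (Fin 2) ℤ →+* PowerSeries ℤ :=
  (MvPowerSeries.substAlgHom (R := ℤ) hasSubst_zero).toRingHom

/-- The Hilbert series of the bosonic part of `Ωₙ / superPower l C`, with the contribution
`1 / (1 - q)` of each direction transverse to `C` removed. -/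
def reducedHilb {n : ℕ} (l : Multiset (Module.Dual ℂ (Fin n → ℂ)))
    (C : Submodule ℂ (Fin n → ℂ)) : PowerSeries ℤ :=
  (1 - PowerSeries.X) ^ (n - Module.finrank ℂ C) * specZero (quotHilb l C)

lemma specSq_apply (f : MvPowerSeries (Fin 2) ℤ) : specSq f =
    MvPowerSeries.subst ![(PowerSeries.X : PowerSeries ℤ) ^ 2, PowerSeries.X] f :=
  MvPowerSeries.substAlgHom_apply hasSubst_sq f

lemma specZero_apply (f : MvPowerSeries (Fin 2) ℤ) : specZero f =
    MvPowerSeries.subst ![(PowerSeries.X : PowerSeries ℤ), 0] f :=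
  MvPowerSeries.substAlgHom_apply hasSubst_zero f

lemma specSq_X_zero : specSq (MvPowerSeries.X 0) = PowerSeries.X ^ 2 :=
  MvPowerSeries.substAlgHom_X hasSubst_sq 0

lemma specSq_X_one : specSq (MvPowerSeries.X 1) = PowerSeries.X :=
  MvPowerSeries.substAlgHom_X hasSubst_sq 1

lemma specZero_X_zero : specZero (MvPowerSeries.X 0) = PowerSeries.X :=
  MvPowerSeries.substAlgHom_X hasSubst_zero 0

lemma specZero_X_one : specZero (MvPowerSeries.X 1) = 0 :=
  MvPowerSeries.substAlgHom_X hasSubst_zero 1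

lemma one_sub_X_ne_zero : (1 - PowerSeries.X : PowerSeries ℤ) ≠ 0 := fun h => by
  simpa using congrArg (PowerSeries.coeff 0) h

lemma one_add_X_ne_zero : (1 + PowerSeries.X : PowerSeries ℤ) ≠ 0 := fun h => by
  simpa using congrArg (PowerSeries.coeff 0) h

section

variable {n : ℕ} {a : Module.Dual ℂ (Fin n → ℂ)} {l : Multiset (Module.Dual ℂ (Fin n → ℂ))}
  {C : Submodule ℂ (Fin n → ℂ)}

/-- Both `(q², q)` and `(q, 0)` satisfy the relation `1 - q = (1 - x) (1 + t)`, which turns the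
factor `(1 + t) / (1 - q)` of a free direction into `1 / (1 - x)`. -/
lemma one_sub_X_pow_mul_spec_quotHilb_zero {σ : MvPowerSeries (Fin 2) ℤ →+* PowerSeries ℤ}
    (h : 1 - σ (MvPowerSeries.X 0) = (1 - PowerSeries.X) * (1 + σ (MvPowerSeries.X 1)))
    (h0 : 1 + σ (MvPowerSeries.X 1) ≠ 0) (C : Submodule ℂ (Fin n → ℂ)) :
    (1 - PowerSeries.X) ^ (n - Module.finrank ℂ C) * σ (quotHilb 0 C) = 1 := by
  induction C using WellFoundedGT.induction with | _ C ih
  rcases eq_or_ne C ⊤ with rfl | hC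
  · rw [quotHilb_zero_top, map_one, finrank_top, Module.finrank_fin_fun, Nat.sub_self, pow_zero,
      mul_one]
  · obtain ⟨D, hD, a, ha, rfl⟩ := exists_inf_ker_eq hC
    have hs := congrArg σ (quotHilb_zero_inf_ker ha)
    simp only [map_mul, map_sub, map_add, map_one, h] at hs
    rw [mul_assoc, mul_left_comm] at hs
    rw [codim_inf_ker ha, pow_succ, mul_assoc, mul_left_cancel₀ h0 hs, ih D hD]

theorem reducedHilb_zero (C : Submodule ℂ (Fin n → ℂ)) : reducedHilb 0 C = 1 :=
  one_sub_X_pow_mul_spec_quotHilb_zero (by rw [specZero_X_zero, specZero_X_one]; ring)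
    (by rw [specZero_X_one, add_zero]; exact one_ne_zero) C

theorem reducedHilb_cons_of_le_ker (hC : C ≤ LinearMap.ker a) :
    reducedHilb (a ::ₘ l) C = reducedHilb l C := by
  rw [reducedHilb, quotHilb, superPower_cons_of_le_ker hC, reducedHilb, quotHilb]

theorem reducedHilb_cons (hC : ¬ C ≤ LinearMap.ker a) : reducedHilb (a ::ₘ l) C =
    PowerSeries.X * reducedHilb l C + reducedHilb l (C ⊓ LinearMap.ker a) := by
  rw [reducedHilb, quotHilb_cons, reducedHilb, reducedHilb, codim_inf_ker hC]
  simp only [map_mul, map_add, map_sub, map_one, specZero_X_zero]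
  ring

lemma reducedHilb_top (l : Multiset (Module.Dual ℂ (Fin n → ℂ))) :
    reducedHilb l ⊤ = specZero (quotHilb l ⊤) := by
  rw [reducedHilb, finrank_top, Module.finrank_fin_fun, Nat.sub_self, pow_zero, one_mul]

theorem specSq_quotHilb (l : Multiset (Module.Dual ℂ (Fin n → ℂ)))
    (C : Submodule ℂ (Fin n → ℂ)) : specSq (quotHilb l C) = specZero (quotHilb (l + l) C) := by
  induction l using Multiset.induction generalizing C with
  | empty =>
    have hsq := one_sub_X_pow_mul_spec_quotHilb_zero (σ := specSq)
      (by rw [specSq_X_zero, specSq_X_one]; ring)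
      (by rw [specSq_X_one]; exact one_add_X_ne_zero) C
    exact mul_left_cancel₀ (pow_ne_zero _ one_sub_X_ne_zero)
      (hsq.trans (reducedHilb_zero C).symm)
  | cons a l ih =>
    rw [Multiset.cons_add, Multiset.add_cons]
    simp only [quotHilb_cons, map_mul, map_add, map_sub, map_one, specSq_X_zero, specZero_X_zero,
      ih, inf_assoc, inf_idem]
    ring

end

lemma coeff_le_coeff_specSq {f : MvPowerSeries (Fin 2) ℤ}
    (hf : ∀ e, 0 ≤ MvPowerSeries.coeff e f) (e : Fin 2 →₀ ℕ) :
    MvPowerSeries.coeff e f ≤ PowerSeries.coeff (2 * e 0 + e 1) (specSq f) := by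
  have prod_eq (d : Fin 2 →₀ ℕ) :
      (d.prod fun s k => ![(PowerSeries.X : PowerSeries ℤ) ^ 2, PowerSeries.X] s ^ k) =
        PowerSeries.X ^ (2 * d 0 + d 1) := by
    rw [Finsupp.prod_fintype _ _ fun _ => pow_zero _, Fin.prod_univ_two, pow_add, pow_mul]
    rfl
  have term_eq (d : Fin 2 →₀ ℕ) (N : ℕ) : MvPowerSeries.coeff d f •
      MvPowerSeries.coeff (Finsupp.single () N)
        (d.prod fun s k => ![(PowerSeries.X : PowerSeries ℤ) ^ 2, PowerSeries.X] s ^ k) =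
      if N = 2 * d 0 + d 1 then MvPowerSeries.coeff d f else 0 := by
    rw [prod_eq]
    change _ • PowerSeries.coeff N _ = _
    rw [PowerSeries.coeff_X_pow, smul_ite, smul_eq_mul, mul_one, smul_zero]
  have hfin := MvPowerSeries.coeff_subst_finite hasSubst_sq f (Finsupp.single () (2 * e 0 + e 1))
  have hcoeff := MvPowerSeries.coeff_subst hasSubst_sq f (Finsupp.single () (2 * e 0 + e 1))
  rw [specSq_apply]
  refine le_of_le_of_eq ?_ hcoeff.symm
  refine le_of_eq_of_le ?_ (single_le_finsum e hfin fun d => ?_)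
  · rw [term_eq, if_pos rfl]
  · rw [term_eq]
    split_ifs
    exacts [hf d, le_rfl]

lemma coeff_specZero (i : ℕ) (f : MvPowerSeries (Fin 2) ℤ) :
    PowerSeries.coeff i (specZero f) = MvPowerSeries.coeff (Finsupp.single 0 i) f := by
  have prod_eq (e : Fin 2 →₀ ℕ) :
      (e.prod fun s k => ![(PowerSeries.X : PowerSeries ℤ), 0] s ^ k) =
        PowerSeries.X ^ e 0 * 0 ^ e 1 := by
    rw [Finsupp.prod_fintype _ _ fun _ => pow_zero _, Fin.prod_univ_two]
    rfl
  rw [specZero_apply]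
  refine (MvPowerSeries.coeff_subst hasSubst_zero f (Finsupp.single () i)).trans ?_
  simp only [prod_eq]
  change ∑ᶠ e, _ • PowerSeries.coeff i _ = _
  rw [finsum_eq_single _ (Finsupp.single 0 i)]
  · simp
  · intro e he
    rcases Nat.eq_zero_or_pos (e 1) with h | h
    · rw [h, pow_zero, mul_one, PowerSeries.coeff_X_pow, if_neg, smul_zero]
      rintro rfl
      refine he (Finsupp.ext <| Fin.forall_fin_two.mpr ⟨?_, ?_⟩)
      · rw [Finsupp.single_eq_same]
      · rw [h, Finsupp.single_eq_of_ne one_ne_zero]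
    · rw [zero_pow h.ne', mul_zero, map_zero, smul_zero]

lemma specSq_coe (F : MvPolynomial (Fin 2) ℤ) : specSq F =
    (MvPolynomial.aeval ![(Polynomial.X : Polynomial ℤ) ^ 2, Polynomial.X] F : Polynomial ℤ) := by
  refine (MvPowerSeries.substAlgHom_coe hasSubst_sq F).trans ?_
  change _ = Polynomial.coeToPowerSeries.ringHom
    (MvPolynomial.aeval ![Polynomial.X ^ 2, Polynomial.X] F)
  rw [MvPolynomial.aeval_def, MvPolynomial.aeval_def, MvPolynomial.hom_eval₂]
  congr 1
  · exact Subsingleton.elim _ _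
  · refine funext <| Fin.forall_fin_two.mpr ⟨?_, ?_⟩
    · exact ((Polynomial.coe_pow _).trans (congrArg (· ^ 2) Polynomial.coe_X)).symm
    · exact Polynomial.coe_X.symm

theorem exists_mvPolynomial_of_specSq_eq {f : MvPowerSeries (Fin 2) ℤ}
    (hf : ∀ e, 0 ≤ MvPowerSeries.coeff e f) {P : Polynomial ℤ}
    (hP : specSq f = (P : PowerSeries ℤ)) :
    ∃ F : MvPolynomial (Fin 2) ℤ, (F : MvPowerSeries (Fin 2) ℤ) = f ∧
      MvPolynomial.eval 1 F = P.eval 1 := by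
  set bound : Fin 2 →₀ ℕ := Finsupp.equivFunOnFinite.symm fun _ => P.natDegree with hbound
  set F := MvPowerSeries.trunc' ℤ bound f with hF
  have coe_F : (F : MvPowerSeries (Fin 2) ℤ) = f := by
    ext e
    rw [MvPolynomial.coeff_coe, hF, MvPowerSeries.coeff_trunc']
    refine ite_eq_left_iff.mpr fun h => (hf e).antisymm ?_
    refine (coeff_le_coeff_specSq hf e).trans_eq ?_
    rw [hP, Polynomial.coeff_coe, Polynomial.coeff_eq_zero_of_natDegree_lt]
    by_contra! hle
    refine h (Fin.forall_fin_two.mpr ⟨?_, ?_⟩) <;>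
      simp only [hbound, Finsupp.equivFunOnFinite_symm_apply_apply] <;> omega
  refine ⟨F, coe_F, ?_⟩
  have hPF : P = MvPolynomial.aeval ![Polynomial.X ^ 2, Polynomial.X] F :=
    Polynomial.coe_injective ℤ (by rw [← hP, ← coe_F, specSq_coe])
  have hone : (1 : Fin 2 → ℤ) = fun i =>
      (Polynomial.aeval (1 : ℤ)) (![Polynomial.X ^ 2, Polynomial.X] i : Polynomial ℤ) :=
    funext <| Fin.forall_fin_two.mpr ⟨by simp, by simp⟩
  rw [hPF, ← Polynomial.coe_aeval_eq_eval, MvPolynomial.comp_aeval_apply, ← hone,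
    MvPolynomial.aeval_eq_eval]

/-! ### The differential closure of a power ideal -/

section

variable {n : ℕ} {v : Fin n → ℂ} {f : Superspace n}

lemma polyDeriv_proj (k : Fin n) :
    polyDeriv (LinearMap.proj k) = MvPolynomial.pderiv (R := ℂ) k := by
  refine MvPolynomial.derivation_ext fun i => ?_
  rw [← linearForm_single, polyDeriv_linearForm, linearForm_single, MvPolynomial.pderiv_X,
    LinearMap.proj_apply, Pi.single_comm]
  by_cases h : i = k
  · subst h; simp
  · simp [h]

lemma euler_apply (f : Superspace n) :
    euler n f = ∑ k, dBos (LinearMap.proj k) f * fer (Pi.single k 1) := by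
  rw [euler, LinearMap.sum_apply]
  refine Finset.sum_congr rfl fun k _ => ?_
  rw [dBos, polyDeriv_proj]
  induction f using TensorProduct.induction_on with
  | zero => simp
  | tmul p w => simp [fer_apply, theta]
  | add f g hf hg => rw [map_add, map_add, add_mul, hf, hg]

lemma euler_one : euler n 1 = 0 := by
  simp [euler_apply, dBos_one]

lemma fer_eq_sum (v : Fin n → ℂ) : fer v = ∑ k, v k • fer (Pi.single k (1 : ℂ)) := by
  conv_lhs => rw [pi_eq_sum_univ' v, map_sum]
  simp only [map_smul]

lemma euler_bos_pow_mul (v : Fin n → ℂ) (k : ℕ) (f : Superspace n) :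
    euler n (bos v ^ (k + 1) * f) =
      ((k + 1 : ℕ) : ℂ) • (bos v ^ k * (f * fer v)) + bos v ^ (k + 1) * euler n f := by
  simp only [euler_apply, dBos_bos_pow_mul, Finset.mul_sum, add_mul, Finset.sum_add_distrib]
  congr 1
  · conv_rhs => rw [fer_eq_sum v, Finset.mul_sum, Finset.mul_sum, Finset.smul_sum]
    refine Finset.sum_congr rfl fun i _ => ?_
    rw [smul_mul_assoc, mul_smul_comm, mul_smul_comm, smul_smul, mul_assoc, LinearMap.proj_apply]
  · simp only [mul_assoc]

lemma euler_fer_mul (v : Fin n → ℂ) (f : Superspace n) :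
    euler n (fer v * f) = fer v * euler n f := by
  simp only [euler_apply, dBos_fer_mul, Finset.mul_sum, mul_assoc]

lemma fer_mul_mul_fer (v : Fin n → ℂ) (f : Superspace n) : fer v * f * fer v = 0 := by
  obtain ⟨f', h⟩ := exists_mul_fer f
  rw [mul_assoc, h, ← mul_assoc, fer_mul_self, zero_mul]

lemma euler_mem_superPower {l : Multiset (Module.Dual ℂ (Fin n → ℂ))}
    {C : Submodule ℂ (Fin n → ℂ)} (hf : f ∈ superPower l C) : euler n f ∈ superPower l C := by
  suffices key : superPower l C ≤ (superPower l C).comap (euler n) from key hf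
  refine superPower_le (fun v hv g => ?_) (fun v hv g => ?_) <;> rw [Submodule.mem_comap]
  · obtain ⟨g', hg⟩ := exists_mul_fer g
    rw [euler_bos_pow_mul, hg]
    exact Submodule.add_mem _
      (Submodule.smul_mem _ _ (bos_pow_mul_fer_mul_mem_superPower hv le_rfl _))
      (bos_pow_mul_mem_superPower hv le_rfl _)
  · rcases hk : covecRho l v with _ | k
    · rw [pow_zero, one_mul, euler_fer_mul, ← one_mul (fer v * _), ← pow_zero (bos v)]
      exact bos_pow_mul_fer_mul_mem_superPower hv hk.le _
    · rw [euler_bos_pow_mul, fer_mul_mul_fer, mul_zero, smul_zero, zero_add, euler_fer_mul]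
      exact bos_pow_mul_fer_mul_mem_superPower hv hk.le _

lemma linearForm_pow_tmul (v : Fin n → ℂ) (k : ℕ) :
    (linearForm v ^ k) ⊗ₜ[ℂ] (1 : ExteriorAlgebra ℂ (Fin n → ℂ)) = bos v ^ k := by
  rw [bos_apply, Algebra.TensorProduct.tmul_pow, one_pow]

lemma superPower_le_of_isTwoSided {l : Multiset (Module.Dual ℂ (Fin n → ℂ))}
    {C : Submodule ℂ (Fin n → ℂ)} {I : Ideal (Superspace n)} [I.IsTwoSided]
    (hd : ∀ f ∈ I, euler n f ∈ I) (hI : ∀ v ∈ C, v ≠ 0 → bos v ^ (covecRho l v + 1) ∈ I) :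
    superPower l C ≤ I.restrictScalars ℂ := by
  have hbos (v) (hv : v ∈ C) : bos v ^ (covecRho l v + 1) ∈ I := by
    rcases eq_or_ne v 0 with rfl | hv0
    · rw [map_zero, pow_succ, mul_zero]
      exact I.zero_mem
    · exact hI v hv hv0
  refine superPower_le (fun v hv g => I.mul_mem_right g (hbos v hv)) (fun v hv g => ?_)
  have hfer : bos v ^ covecRho l v * fer v ∈ I.restrictScalars ℂ := by
    have h := hd _ (hbos v hv)
    rw [← mul_one (bos v ^ _), euler_bos_pow_mul, euler_one, mul_zero, add_zero, one_mul] at h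
    exact ((I.restrictScalars ℂ).smul_mem_iff (Nat.cast_ne_zero.mpr (Nat.succ_ne_zero _))).mp h
  rw [← mul_assoc]
  exact I.mul_mem_right g hfer

end

namespace Multiarrangement

/-- The linear form cutting out the `i`-th hyperplane. -/
def covec {n : ℕ} {ι : Type*} (A : Multiarrangement ℂ n ι) (i : ι) : Module.Dual ℂ (Fin n → ℂ) :=
  dotProductBilin ℂ ℂ (A.normal i)

/-- The multiset of the linear forms cutting out the hyperplanes. -/
def covectors {n : ℕ} {ι : Type*} [Fintype ι] (A : Multiarrangement ℂ n ι) :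
    Multiset (Module.Dual ℂ (Fin n → ℂ)) :=
  Finset.univ.val.map A.covec

variable {n : ℕ} {ι : Type*} [Fintype ι]

lemma rho_eq_covecRho (A : Multiarrangement ℂ n ι) (v : Fin n → ℂ) :
    A.rho v = covecRho A.covectors v := by
  classical
  have hset : {i | ¬ Submodule.span ℂ {v} ≤ A.hyperplane i} =
      ↑(Finset.univ.filter fun i => A.covec i v ≠ 0) := by
    ext i
    rw [Set.mem_ofPred_eq, Submodule.span_singleton_le_iff_mem, Finset.mem_coe,
      Finset.mem_filter_univ]
    rfl
  rw [rho, hset, Set.ncard_coe_finset, covecRho, covectors, Multiset.countP_map]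
  congr

lemma covectors_double (A : Multiarrangement ℂ n ι) :
    A.double.covectors = A.covectors + A.covectors := by
  rw [covectors, ← Finset.univ_disjSum_univ, Finset.val_disjSum, Multiset.disjSum,
    Multiset.map_add, Multiset.map_map, Multiset.map_map]
  rfl

end Multiarrangement

section

variable {n : ℕ} {ι : Type*} [Fintype ι]

lemma tmul_one_mem_of_mem_powerIdeal {A : Multiarrangement ℂ n ι} {p : MvPolynomial (Fin n) ℂ}
    (hp : p ∈ powerIdeal A 1) :
    p ⊗ₜ[ℂ] (1 : ExteriorAlgebra ℂ (Fin n → ℂ)) ∈ superPower A.covectors ⊤ := by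
  induction hp using Submodule.span_induction with
  | mem p hp =>
    obtain ⟨v, -, rfl⟩ := hp
    rw [linearForm_pow_tmul, A.rho_eq_covecRho, ← mul_one (bos v ^ _)]
    exact bos_pow_mul_mem_superPower Submodule.mem_top le_rfl _
  | zero => rw [TensorProduct.zero_tmul]; exact Submodule.zero_mem _
  | add p q _ _ hp hq => rw [TensorProduct.add_tmul]; exact Submodule.add_mem _ hp hq
  | smul c p _ hp =>
    have h := mul_mem_superPower_left hp (c ⊗ₜ 1)
    rwa [Algebra.TensorProduct.tmul_mul_tmul, one_mul] at h

theorem superIdeal_eq_superPower (A : Multiarrangement ℂ n ι) :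
    (superIdeal A).restrictScalars ℂ = superPower A.covectors ⊤ := by
  refine le_antisymm ?_ ?_
  · let J : Ideal (Superspace n) :=
      { superPower A.covectors ⊤ with
        smul_mem' := fun c _ hf => mul_mem_superPower_left hf c }
    have hJ : superIdeal A ≤ J := sInf_le ⟨⟨fun h hf => mul_mem_superPower_right hf h⟩,
      fun _ => euler_mem_superPower, fun _ => tmul_one_mem_of_mem_powerIdeal⟩
    exact hJ
  · refine fun f hf => Submodule.mem_sInf.mpr fun I ⟨_, hd, hI⟩ =>
      superPower_le_of_isTwoSided hd (fun v _ hv => ?_) hf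
    rw [← linearForm_pow_tmul, ← A.rho_eq_covecRho]
    exact hI _ (Ideal.subset_span ⟨v, hv, rfl⟩)

lemma ker_mkQ_restrictScalars {R : Type*} [Ring R] [Algebra ℂ R] (I : Ideal R) :
    LinearMap.ker (I.mkQ.restrictScalars ℂ) = I.restrictScalars ℂ := by
  rw [LinearMap.ker_restrictScalars, Submodule.ker_mkQ]

lemma hilbSuper_eq_sub (I : Ideal (Superspace n)) :
    hilbSuper I = hilb (n := n) ⊤ - hilb (I.restrictScalars ℂ) := by
  ext e
  rw [map_sub, coeff_hilb, coeff_hilb, top_inf_eq, inf_comm, ← ker_mkQ_restrictScalars,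
    ← finrank_map_add_finrank_inf_ker (I.mkQ.restrictScalars ℂ) (bidegree n (e 0) (e 1)),
    Nat.cast_add, add_sub_cancel_right]
  rfl

theorem hilbSuper_superIdeal (A : Multiarrangement ℂ n ι) :
    hilbSuper (superIdeal A) = quotHilb A.covectors ⊤ := by
  rw [hilbSuper_eq_sub, superIdeal_eq_superPower, quotHilb]

/-- The inclusion `p ↦ p ⊗ 1`. -/
def inclPoly (n : ℕ) : MvPolynomial (Fin n) ℂ →ₐ[ℂ] Superspace n :=
  Algebra.TensorProduct.includeLeft

/-- The retraction of `Ωₙ` onto the polynomial ring that sets all `θᵢ` to zero. -/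
def retrPoly (n : ℕ) : Superspace n →ₐ[ℂ] MvPolynomial (Fin n) ℂ :=
  Algebra.TensorProduct.lift (AlgHom.id ℂ _)
    ((Algebra.ofId ℂ (MvPolynomial (Fin n) ℂ)).comp ExteriorAlgebra.algebraMapInv)
    fun _ _ => Commute.all _ _

lemma inclPoly_apply (p : MvPolynomial (Fin n) ℂ) : inclPoly n p = p ⊗ₜ 1 := rfl

lemma retrPoly_inclPoly (p : MvPolynomial (Fin n) ℂ) : retrPoly n (inclPoly n p) = p := by
  simp [retrPoly, inclPoly_apply]

lemma inclPoly_injective : Function.Injective (inclPoly n) :=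
  Function.LeftInverse.injective retrPoly_inclPoly

lemma retrPoly_bos (v : Fin n → ℂ) : retrPoly n (bos v) = linearForm v := by
  simp [retrPoly, bos_apply]

lemma retrPoly_fer (v : Fin n → ℂ) : retrPoly n (fer v) = 0 := by
  simp [retrPoly, fer_apply, ExteriorAlgebra.algebraMapInv]

lemma retrPoly_mem_powerIdeal {A : Multiarrangement ℂ n ι} {f : Superspace n}
    (hf : f ∈ superPower A.covectors ⊤) : retrPoly n f ∈ powerIdeal A 1 := by
  suffices key : superPower A.covectors ⊤ ≤
      ((powerIdeal A 1).restrictScalars ℂ).comap (retrPoly n).toLinearMap from key hf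
  refine superPower_le (fun v _ g => ?_) (fun v _ g => ?_) <;>
    rw [Submodule.mem_comap, Submodule.restrictScalars_mem, AlgHom.toLinearMap_apply, map_mul]
  · rw [map_pow, retrPoly_bos, ← A.rho_eq_covecRho]
    refine Ideal.mul_mem_right _ _ ?_
    rcases eq_or_ne v 0 with rfl | hv
    · simp [linearForm, pow_succ]
    · exact Ideal.subset_span ⟨v, hv, rfl⟩
  · rw [map_mul, retrPoly_fer, zero_mul, mul_zero]
    exact Ideal.zero_mem _

lemma inclPoly_mem_superPower_iff {A : Multiarrangement ℂ n ι} {p : MvPolynomial (Fin n) ℂ} :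
    inclPoly n p ∈ superPower A.covectors ⊤ ↔ p ∈ powerIdeal A 1 :=
  ⟨fun h => retrPoly_inclPoly p ▸ retrPoly_mem_powerIdeal h, tmul_one_mem_of_mem_powerIdeal⟩

lemma bidegree_zero_right (i : ℕ) : bidegree n i 0 =
    (MvPolynomial.homogeneousSubmodule (Fin n) ℂ i).map (inclPoly n).toLinearMap := by
  refine le_antisymm (bidegree_le fun p hp ω hω => ?_) ?_
  · obtain ⟨c, rfl⟩ := exists_algebraMap_eq_of_mem_exteriorPower_zero hω
    refine ⟨c • p, Submodule.smul_mem _ _ hp, ?_⟩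
    rw [AlgHom.toLinearMap_apply, inclPoly_apply, TensorProduct.smul_tmul,
      Algebra.algebraMap_eq_smul_one]
  · rintro _ ⟨p, hp, rfl⟩
    exact tmul_mem_bidegree hp (by simp)

lemma superPower_inf_bidegree_zero_right (A : Multiarrangement ℂ n ι) (i : ℕ) :
    superPower A.covectors ⊤ ⊓ bidegree n i 0 =
      (MvPolynomial.homogeneousSubmodule (Fin n) ℂ i ⊓
        (powerIdeal A 1).restrictScalars ℂ).map (inclPoly n).toLinearMap := by
  rw [bidegree_zero_right]
  ext f
  constructor
  · rintro ⟨hf, p, hp, rfl⟩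
    exact ⟨p, ⟨hp, inclPoly_mem_superPower_iff.mp hf⟩, rfl⟩
  · rintro ⟨p, ⟨hp, hpJ⟩, rfl⟩
    exact ⟨inclPoly_mem_superPower_iff.mpr hpJ, p, hp, rfl⟩

theorem hilbPoly_powerIdeal (A : Multiarrangement ℂ n ι) :
    hilbPoly (powerIdeal A 1) = specZero (quotHilb A.covectors ⊤) := by
  ext i
  have finrank_map (M : Submodule ℂ (MvPolynomial (Fin n) ℂ)) :
      Module.finrank ℂ ↥(M.map (inclPoly n).toLinearMap) = Module.finrank ℂ M :=
    (Submodule.equivMapOfInjective _ inclPoly_injective M).finrank_eq.symm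
  have : Module.Finite ℂ (MvPolynomial.homogeneousSubmodule (Fin n) ℂ i) :=
    Module.Finite.iff_fg.mpr (MvPolynomial.homogeneousSubmodule_fg (σ := Fin n) (R := ℂ) i)
  rw [coeff_specZero, quotHilb, map_sub, coeff_hilb, coeff_hilb, top_inf_eq,
    Finsupp.single_eq_same, Finsupp.single_eq_of_ne one_ne_zero,
    superPower_inf_bidegree_zero_right, bidegree_zero_right, finrank_map, finrank_map,
    ← ker_mkQ_restrictScalars, ← finrank_map_add_finrank_inf_ker
      ((powerIdeal A 1).mkQ.restrictScalars ℂ) (MvPolynomial.homogeneousSubmodule (Fin n) ℂ i),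
    Nat.cast_add, add_sub_cancel_right, hilbPoly, PowerSeries.coeff_mk]

end

theorem subst_hilbSuper_superIdeal {n : ℕ} {ι : Type*} [Finite ι] (A : Multiarrangement ℂ n ι) :
    MvPowerSeries.subst ![(PowerSeries.X : PowerSeries ℤ) ^ 2, PowerSeries.X]
      (hilbSuper (superIdeal A)) = hilbPoly (powerIdeal A.double 1) := by
  have := Fintype.ofFinite ι
  rw [← specSq_apply, hilbSuper_superIdeal, hilbPoly_powerIdeal, A.covectors_double,
    specSq_quotHilb]

lemma finrank_finset_sup {K V ι : Type*} [DivisionRing K] [AddCommGroup V] [Module K V]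
    {N : ι → Submodule K V} [∀ i, Module.Finite K (N i)] (S : Finset ι) (hN : S.SupIndep N) :
    Module.finrank K ↥(S.sup N) = ∑ i ∈ S, Module.finrank K (N i) := by
  classical
  induction S using Finset.induction_on with
  | empty => simp
  | insert i S hi ih =>
    have hdisj : N i ⊓ S.sup N = ⊥ :=
      (hN (Finset.subset_insert i S) (Finset.mem_insert_self i S) hi).eq_bot
    have : Module.Finite K ↥(S.sup N) := Submodule.finiteDimensional_finset_sup S N
    have h := Submodule.finrank_sup_add_finrank_inf_eq (N i) (S.sup N)
    rw [hdisj, finrank_bot, add_zero] at h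
    rw [Finset.sup_insert, h, ih (hN.subset (Finset.subset_insert i S)), Finset.sum_insert hi]

section

variable {n : ℕ} {I : Ideal (Superspace n)}

lemma iSup_map_bidegree {V : Type*} [AddCommGroup V] [Module ℂ V] (T : Superspace n →ₗ[ℂ] V)
    (hT : Function.Surjective T) : ⨆ e : Fin 2 →₀ ℕ, (bidegree n (e 0) (e 1)).map T = ⊤ := by
  rw [← Submodule.map_iSup, eq_top_iff, ← LinearMap.range_eq_top.mpr hT, ← Submodule.map_top]
  refine Submodule.map_mono fun f _ => ?_
  induction f using bidegree_induction with
  | add f g hf hg => exact Submodule.add_mem _ (hf trivial) (hg trivial)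
  | mem i j f hf => exact Submodule.mem_iSup_of_mem (Finsupp.equivFunOnFinite.symm ![i, j]) hf

lemma iSupIndep_map_bidegree {V : Type*} [AddCommGroup V] [Module ℂ V]
    (T : Superspace n →ₗ[ℂ] V) (hT : IsGraded (LinearMap.ker T)) :
    iSupIndep fun e : Fin 2 →₀ ℕ => (bidegree n (e 0) (e 1)).map T := by
  intro e
  rw [disjoint_iff, eq_bot_iff]
  simp only [← Submodule.map_iSup]
  rintro _ ⟨⟨f, hf, rfl⟩, g, hg, hgf⟩
  have hproj : bidegreeProj n (e 0, e 1) g = 0 := by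
    suffices h : (⨆ e', ⨆ _ : e' ≠ e, bidegree n (e' 0) (e' 1)) ≤
      LinearMap.ker (bidegreeProj n (e 0, e 1)) from h hg
    refine iSup₂_le fun e' he f' hf' => ?_
    rw [LinearMap.mem_ker, bidegreeProj_of_mem hf', if_neg]
    exact fun h => he <| Finsupp.ext <| Fin.forall_fin_two.mpr
      ⟨(congrArg Prod.fst h).symm, (congrArg Prod.snd h).symm⟩
  have hker := hT (f - g) (by rw [LinearMap.mem_ker, map_sub, hgf, sub_self]) (e 0, e 1)
  rwa [map_sub, hproj, sub_zero, bidegreeProj_of_mem hf, if_pos rfl] at hker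

theorem finite_and_finrank_quotient (hI : IsGraded (I.restrictScalars ℂ))
    {F : MvPolynomial (Fin 2) ℤ} (hF : (F : MvPowerSeries (Fin 2) ℤ) = hilbSuper I) :
    Module.Finite ℂ (Superspace n ⧸ I) ∧
      (Module.finrank ℂ (Superspace n ⧸ I) : ℤ) = MvPolynomial.eval 1 F := by
  let N : (Fin 2 →₀ ℕ) → Submodule ℂ (Superspace n ⧸ I) := fun e =>
    (bidegree n (e 0) (e 1)).map (I.mkQ.restrictScalars ℂ)
  have finrank_N (e) : (Module.finrank ℂ (N e) : ℤ) = F.coeff e := by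
    rw [← MvPolynomial.coeff_coe, hF]
    rfl
  have hindep : iSupIndep N :=
    iSupIndep_map_bidegree _ ((ker_mkQ_restrictScalars I).symm ▸ hI)
  have hsup : F.support.sup N = ⊤ := by
    rw [eq_top_iff, ← iSup_map_bidegree (I.mkQ.restrictScalars ℂ) I.mkQ_surjective]
    refine iSup_le fun e => ?_
    by_cases he : e ∈ F.support
    · exact Finset.le_sup (f := N) he
    · have h := finrank_N e
      rw [MvPolynomial.notMem_support_iff.mp he, Nat.cast_eq_zero, Submodule.finrank_eq_zero] at h
      exact h.le.trans bot_le
  have hfin : Module.Finite ℂ ↥(F.support.sup N) := Submodule.finiteDimensional_finset_sup _ _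
  rw [hsup] at hfin
  refine ⟨Module.finite_def.mpr (Module.Finite.iff_fg.mp hfin), ?_⟩
  rw [← finrank_top, ← hsup, finrank_finset_sup _ (hindep.supIndep' _), Nat.cast_sum,
    MvPolynomial.eval_eq]
  simp [finrank_N]

end

/-! ### Generic deformations -/

section

variable {K : Type*} [Field K]

lemma surjective_dotProduct_iff {m s : Type*} [Fintype m] [Finite s] {v : s → m → K} :
    Function.Surjective (fun (x : m → K) (i : s) => v i ⬝ᵥ x) ↔ LinearIndependent K v := by
  classical
  have := Fintype.ofFinite s
  refine ⟨fun h => Fintype.linearIndependent_iff.mpr fun c hc i => ?_, fun hv c => ?_⟩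
  · obtain ⟨x, hx⟩ := h (Pi.single i 1)
    calc c i = ∑ k, c k * (v k ⬝ᵥ x) := by simp [fun k => congrFun hx k, Pi.single_apply]
      _ = (∑ k, c k • v k) ⬝ᵥ x := by simp only [sum_dotProduct, smul_dotProduct, smul_eq_mul]
      _ = 0 := by rw [hc, zero_dotProduct]
  · obtain ⟨φ, hφ⟩ := LinearMap.exists_extend ((Module.Basis.span hv).constr K c)
    refine ⟨fun j => φ (Pi.single j 1), funext fun i => ?_⟩
    calc v i ⬝ᵥ (fun j => φ (Pi.single j 1)) = φ (v i) := by
          conv_rhs => rw [pi_eq_sum_univ' (v i), map_sum]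
          simp only [dotProduct, map_smul, smul_eq_mul]
      _ = c i := by
          have h := LinearMap.congr_fun hφ (Module.Basis.span hv i)
          rwa [Module.Basis.constr_basis, LinearMap.comp_apply, Submodule.subtype_apply,
            Module.Basis.span_apply] at h

namespace Multiarrangement

variable {n : ℕ} {κ : Type*}

/-- The translation vectors for which the translated hyperplanes with index in `S` have a common
point. -/
def concurrentTranslations (A : Multiarrangement K n κ) (S : Finset κ) : Submodule K (κ → K) :=
  (LinearMap.range (LinearMap.pi fun i : S => dotProductBilin K K (A.normal i))).comap
    (LinearMap.funLeft K K Subtype.val)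

variable {A : Multiarrangement K n κ} {S : Finset κ}

lemma mem_concurrentTranslations_iff {b : κ → K} :
    b ∈ A.concurrentTranslations S ↔ (⋂ i ∈ S, A.affineHyperplane b i).Nonempty :=
  exists_congr fun x => by
    rw [Set.mem_iInter₂, funext_iff, Subtype.forall]
    rfl

lemma concurrentTranslations_eq_top_iff :
    A.concurrentTranslations S = ⊤ ↔ LinearIndependent K fun i : S => A.normal i := by
  have hrestrict : Function.Surjective (LinearMap.funLeft K K (Subtype.val : S → κ)) :=
    LinearMap.funLeft_surjective_of_injective _ _ _ Subtype.val_injective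
  rw [concurrentTranslations, ← Submodule.comap_top (LinearMap.funLeft K K (Subtype.val : S → κ)),
    (Submodule.comap_injective_of_surjective hrestrict).eq_iff, LinearMap.range_eq_top,
    ← surjective_dotProduct_iff]
  rfl

theorem exists_isGenericDeformation [Infinite K] [Finite κ] (A : Multiarrangement K n κ) :
    ∃ b : κ → K, A.IsGenericDeformation b := by
  classical
  have := Fintype.ofFinite κ
  let dependent : Finset (Finset κ) :=
    {S | ¬ LinearIndependent K fun i : S => A.normal i}
  have htop : ⊤ ∉ dependent.image A.concurrentTranslations := by
    simp only [dependent, Finset.mem_image, Finset.mem_filter_univ,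
      concurrentTranslations_eq_top_iff, not_exists, not_and, imp_self, implies_true]
  obtain ⟨b, hb⟩ :=
    (Set.ne_univ_iff_exists_notMem _).mp (Subspace.biUnion_ne_univ_of_top_notMem htop)
  refine ⟨b, fun S => mem_concurrentTranslations_iff.symm.trans ⟨fun h => ?_, fun h => ?_⟩⟩
  · by_contra hS
    exact hb <| Set.mem_biUnion
      (Finset.mem_image_of_mem _ (Finset.mem_filter_univ _ |>.mpr hS)) h
  · exact concurrentTranslations_eq_top_iff.mpr h ▸ Submodule.mem_top

end Multiarrangement

end

/-! ### Sign patterns and regions -/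

section

variable {n : ℕ} {κ : Type*}

/-- The value at `x` of the affine form that cuts out the `i`-th affine hyperplane. -/
def affineForm (A : Multiarrangement ℝ n κ) (b : κ → ℝ) (i : κ) (x : Fin n → ℝ) : ℝ :=
  A.normal i ⬝ᵥ x - b i

/-- The cell of an affine arrangement on which the affine forms vanish on `T`, are positive on `P`
and are negative on `N`. -/
def cell (A : Multiarrangement ℝ n κ) (b : κ → ℝ) (T P N : Finset κ) : Set (Fin n → ℝ) :=
  {x | (∀ i ∈ T, affineForm A b i x = 0) ∧ (∀ i ∈ P, 0 < affineForm A b i x) ∧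
    ∀ i ∈ N, affineForm A b i x < 0}

variable {A : Multiarrangement ℝ n κ} {b : κ → ℝ} {S T P N : Finset κ} {i : κ}
  {x v : Fin n → ℝ}

lemma affineForm_add_smul (t : ℝ) :
    affineForm A b i (x + t • v) = affineForm A b i x + t * (A.normal i ⬝ᵥ v) := by
  rw [affineForm, affineForm, dotProduct_add, dotProduct_smul, smul_eq_mul, sub_add_eq_add_sub]

lemma isLinearMap_dotProduct (u : Fin n → ℝ) : IsLinearMap ℝ fun x : Fin n → ℝ => u ⬝ᵥ x :=
  (dotProductBilin ℝ ℝ u).isLinear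

lemma continuous_affineForm (A : Multiarrangement ℝ n κ) (b : κ → ℝ) (i : κ) :
    Continuous (affineForm A b i) := by
  unfold affineForm
  fun_prop

lemma convex_cell (A : Multiarrangement ℝ n κ) (b : κ → ℝ) (T P N : Finset κ) :
    Convex ℝ (cell A b T P N) := by
  have hcell : cell A b T P N = (⋂ i ∈ T, {x | A.normal i ⬝ᵥ x = b i}) ∩
      ((⋂ i ∈ P, {x | b i < A.normal i ⬝ᵥ x}) ∩ ⋂ i ∈ N, {x | A.normal i ⬝ᵥ x < b i}) := by
    ext x
    simp only [cell, affineForm, sub_eq_zero, sub_pos, sub_neg, Set.mem_inter_iff, Set.mem_iInter,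
      Set.mem_ofPred_eq]
  rw [hcell]
  exact (convex_iInter₂ fun i _ => convex_hyperplane (isLinearMap_dotProduct _) _).inter
    ((convex_iInter₂ fun i _ => convex_halfSpace_gt (isLinearMap_dotProduct _) _).inter
      (convex_iInter₂ fun i _ => convex_halfSpace_lt (isLinearMap_dotProduct _) _))

lemma eventually_add_smul_mem_cell (hv : ∀ j ∈ T, A.normal j ⬝ᵥ v = 0)
    (hx : x ∈ cell A b T P N) : ∀ᶠ t : ℝ in nhds 0, x + t • v ∈ cell A b T P N := by
  have hline (i : κ) :
      Filter.Tendsto (fun t : ℝ => affineForm A b i (x + t • v)) (nhds 0)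
        (nhds (affineForm A b i x)) := by
    have hcont : Continuous fun t : ℝ => affineForm A b i (x + t • v) :=
      (continuous_affineForm A b i).comp (by fun_prop)
    simpa only [zero_smul, add_zero] using hcont.tendsto 0
  have hP : ∀ᶠ t : ℝ in nhds 0, ∀ i ∈ P, 0 < affineForm A b i (x + t • v) :=
    (Finset.eventually_all P).mpr fun i hi => (hline i).eventually_const_lt (hx.2.1 i hi)
  have hN : ∀ᶠ t : ℝ in nhds 0, ∀ i ∈ N, affineForm A b i (x + t • v) < 0 :=
    (Finset.eventually_all N).mpr fun i hi => (hline i).eventually_lt_const (hx.2.2 i hi)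
  filter_upwards [hP, hN] with t hPt hNt
  refine ⟨fun j hj => ?_, hPt, hNt⟩
  rw [affineForm_add_smul, hx.1 j hj, hv j hj, mul_zero, add_zero]

variable [DecidableEq κ]

lemma cell_insert_zero :
    cell A b (insert i T) P N = cell A b T P N ∩ {x | affineForm A b i x = 0} := by
  ext x
  simp only [cell, Finset.forall_mem_insert, Set.mem_inter_iff, Set.mem_ofPred_eq]
  tauto

lemma cell_insert_pos :
    cell A b T (insert i P) N = cell A b T P N ∩ {x | 0 < affineForm A b i x} := by
  ext x
  simp only [cell, Finset.forall_mem_insert, Set.mem_inter_iff, Set.mem_ofPred_eq]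
  tauto

lemma cell_insert_neg :
    cell A b T P (insert i N) = cell A b T P N ∩ {x | affineForm A b i x < 0} := by
  ext x
  simp only [cell, Finset.forall_mem_insert, Set.mem_inter_iff, Set.mem_ofPred_eq]
  tauto

lemma nonempty_cell_insert_of_zero (hv : ∀ j ∈ T, A.normal j ⬝ᵥ v = 0)
    (hiv : A.normal i ⬝ᵥ v = 1) (hx : x ∈ cell A b T P N) (hi : affineForm A b i x = 0) :
    (cell A b T (insert i P) N).Nonempty ∧ (cell A b T P (insert i N)).Nonempty := by
  have hform (t : ℝ) : affineForm A b i (x + t • v) = t := by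
    rw [affineForm_add_smul, hi, hiv, zero_add, mul_one]
  have hnear := eventually_add_smul_mem_cell hv hx
  obtain ⟨s, hs, hspos⟩ := ((hnear.filter_mono nhdsWithin_le_nhds).and
    (self_mem_nhdsWithin : Set.Ioi (0 : ℝ) ∈ nhdsWithin 0 (Set.Ioi 0))).exists
  obtain ⟨t, ht, htneg⟩ := ((hnear.filter_mono nhdsWithin_le_nhds).and
    (self_mem_nhdsWithin : Set.Iio (0 : ℝ) ∈ nhdsWithin 0 (Set.Iio 0))).exists
  rw [cell_insert_pos, cell_insert_neg]
  exact ⟨⟨_, hs, hspos.trans_eq (hform s).symm⟩, ⟨_, ht, (hform t).trans_lt htneg⟩⟩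

lemma nonempty_cell_iff_insert (hv : ∀ j ∈ T, A.normal j ⬝ᵥ v = 0)
    (hiv : A.normal i ⬝ᵥ v = 1) : (cell A b T P N).Nonempty ↔
      (cell A b T (insert i P) N).Nonempty ∨ (cell A b T P (insert i N)).Nonempty := by
  constructor
  · rintro ⟨x, hx⟩
    rcases lt_trichotomy (affineForm A b i x) 0 with h | h | h
    · exact Or.inr ⟨x, cell_insert_neg.superset ⟨hx, h⟩⟩
    · exact Or.inl (nonempty_cell_insert_of_zero hv hiv hx h).1
    · exact Or.inl ⟨x, cell_insert_pos.superset ⟨hx, h⟩⟩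
  · rw [cell_insert_pos, cell_insert_neg]
    rintro (h | h) <;> exact h.mono Set.inter_subset_left

lemma nonempty_cell_insert_zero_iff (hv : ∀ j ∈ T, A.normal j ⬝ᵥ v = 0)
    (hiv : A.normal i ⬝ᵥ v = 1) : (cell A b (insert i T) P N).Nonempty ↔
      (cell A b T (insert i P) N).Nonempty ∧ (cell A b T P (insert i N)).Nonempty := by
  constructor
  · rw [cell_insert_zero]
    rintro ⟨x, hx, hi⟩
    exact nonempty_cell_insert_of_zero hv hiv hx hi
  · rw [cell_insert_zero, cell_insert_pos, cell_insert_neg]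
    rintro ⟨⟨x, hx, hxi⟩, ⟨y, hy, hyi⟩⟩
    obtain ⟨z, hz, hzi⟩ := (convex_cell A b T P N).isPreconnected.intermediate_value hy hx
      (continuous_affineForm A b i).continuousOn
      (show (0 : ℝ) ∈ Set.Icc _ _ from ⟨hyi.le, hxi.le⟩)
    exact ⟨z, hz, hzi⟩

/-- The sign patterns on `S` that occur on the flat where the affine forms with index in `T`
vanish; a pattern is recorded by its set of positive indices. -/
def signPatterns (A : Multiarrangement ℝ n κ) (b : κ → ℝ) (S T : Finset κ) : Finset (Finset κ) :=
  letI := Classical.decPred fun p => (cell A b T p (S \ p)).Nonempty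
  S.powerset.filter fun p => (cell A b T p (S \ p)).Nonempty

lemma mem_signPatterns {p : Finset κ} :
    p ∈ signPatterns A b S T ↔ p ⊆ S ∧ (cell A b T p (S \ p)).Nonempty := by
  classical exact Finset.mem_filter.trans (and_congr_left' Finset.mem_powerset)

open Classical in
lemma card_signPatterns_insert (hi : i ∉ S) :
    (signPatterns A b (insert i S) T).card =
      (S.powerset.filter fun p => (cell A b T (insert i p) (S \ p)).Nonempty ∨
        (cell A b T p (insert i (S \ p))).Nonempty).card +
      (S.powerset.filter fun p => (cell A b T (insert i p) (S \ p)).Nonempty ∧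
        (cell A b T p (insert i (S \ p))).Nonempty).card := by
  have hneg : (S.powerset.filter fun p => (cell A b T p (insert i S \ p)).Nonempty) =
      S.powerset.filter fun p => (cell A b T p (insert i (S \ p))).Nonempty :=
    Finset.filter_congr fun p hp => by
      rw [Finset.insert_sdiff_of_notMem _ fun h => hi (Finset.mem_powerset.mp hp h)]
  have hpos : (S.powerset.filter fun p =>
        (cell A b T (insert i p) (insert i S \ insert i p)).Nonempty) =
      S.powerset.filter fun p => (cell A b T (insert i p) (S \ p)).Nonempty :=
    Finset.filter_congr fun p _ => by
      rw [Finset.insert_sdiff_insert, Finset.sdiff_insert_of_notMem hi]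
  have hinj : Set.InjOn (insert i) (S.powerset : Set (Finset κ)) := fun p hp q hq hpq => by
    rw [← Finset.erase_insert fun h => hi (Finset.mem_powerset.mp hp h), hpq,
      Finset.erase_insert fun h => hi (Finset.mem_powerset.mp hq h)]
  have hdisj : Disjoint S.powerset (S.powerset.image (insert i)) :=
    Finset.disjoint_left.mpr fun p hp hp' => by
      obtain ⟨q, -, rfl⟩ := Finset.mem_image.mp hp'
      exact hi (Finset.mem_powerset.mp hp (Finset.mem_insert_self i q))
  rw [signPatterns, Finset.powerset_insert, Finset.filter_union,
    Finset.card_union_of_disjoint (Finset.disjoint_filter_filter hdisj), Finset.filter_image,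
    Finset.card_image_of_injOn (hinj.mono (Finset.coe_subset.mpr (Finset.filter_subset _ _))),
    hneg, hpos, Finset.filter_or, Finset.filter_and, Finset.card_union_add_card_inter, add_comm]

lemma card_signPatterns_insert_of_transverse (hi : i ∉ S) (hv : ∀ j ∈ T, A.normal j ⬝ᵥ v = 0)
    (hiv : A.normal i ⬝ᵥ v = 1) : (signPatterns A b (insert i S) T).card =
      (signPatterns A b S T).card + (signPatterns A b S (insert i T)).card := by
  classical
  simp only [card_signPatterns_insert hi, ← nonempty_cell_iff_insert hv hiv,
    ← nonempty_cell_insert_zero_iff hv hiv]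
  rfl

lemma card_signPatterns_insert_of_parallel (hi : i ∉ S) {c : ℝ} (hc : c ≠ 0)
    (hT : ∀ x, (∀ j ∈ T, affineForm A b j x = 0) → affineForm A b i x = c) :
    (signPatterns A b (insert i S) T).card = (signPatterns A b S T).card := by
  have hpos (P N : Finset κ) :
      (cell A b T (insert i P) N).Nonempty ↔ (cell A b T P N).Nonempty ∧ 0 < c := by
    rw [cell_insert_pos]
    exact ⟨fun ⟨x, hx, h⟩ => ⟨⟨x, hx⟩, hT x hx.1 ▸ h⟩,
      fun ⟨⟨x, hx⟩, h⟩ => ⟨x, hx, h.trans_eq (hT x hx.1).symm⟩⟩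
  have hneg (P N : Finset κ) :
      (cell A b T P (insert i N)).Nonempty ↔ (cell A b T P N).Nonempty ∧ c < 0 := by
    rw [cell_insert_neg]
    exact ⟨fun ⟨x, hx, h⟩ => ⟨⟨x, hx⟩, hT x hx.1 ▸ h⟩,
      fun ⟨⟨x, hx⟩, h⟩ => ⟨x, hx, (hT x hx.1).trans_lt h⟩⟩
  have hsign : ¬ (0 < c ∧ c < 0) := fun h => h.1.not_gt h.2
  classical
  simp only [card_signPatterns_insert hi, hpos, hneg, ← and_or_left, ← and_and_left,
    hc.symm.lt_or_gt, hsign, and_true, and_false, Finset.filter_false, Finset.card_empty, add_zero]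
  rfl

end

namespace Multiarrangement

variable {n : ℕ} {κ : Type*}

/-- The flat of the arrangement given by the index set `T`. -/
def flat (A : Multiarrangement ℂ n κ) (T : Finset κ) : Submodule ℂ (Fin n → ℂ) :=
  T.inf fun j => LinearMap.ker (A.covec j)

lemma mem_flat_iff {A : Multiarrangement ℂ n κ} {T : Finset κ} {v : Fin n → ℂ} :
    v ∈ A.flat T ↔ ∀ j ∈ T, A.covec j v = 0 := by
  simp only [flat, Submodule.mem_finsetInf, LinearMap.mem_ker]

lemma flat_empty (A : Multiarrangement ℂ n κ) : A.flat ∅ = ⊤ :=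
  Finset.inf_empty

lemma flat_insert [DecidableEq κ] (A : Multiarrangement ℂ n κ) (i : κ) (T : Finset κ) :
    A.flat (insert i T) = A.flat T ⊓ LinearMap.ker (A.covec i) := by
  rw [flat, Finset.inf_insert, inf_comm, flat]

variable {A : Multiarrangement ℝ n κ}

lemma complexify_covec_ofReal (A : Multiarrangement ℝ n κ) (i : κ) (v : Fin n → ℝ) :
    A.complexify.covec i (fun j => (v j : ℂ)) = ((A.normal i ⬝ᵥ v : ℝ) : ℂ) := by
  simp [covec, dotProduct, complexify]

lemma re_complexify_covec (A : Multiarrangement ℝ n κ) (i : κ) (v : Fin n → ℂ) :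
    (A.complexify.covec i v).re = A.normal i ⬝ᵥ fun j => (v j).re := by
  simp [covec, dotProduct, complexify]

lemma im_complexify_covec (A : Multiarrangement ℝ n κ) (i : κ) (v : Fin n → ℂ) :
    (A.complexify.covec i v).im = A.normal i ⬝ᵥ fun j => (v j).im := by
  simp [covec, dotProduct, complexify]

lemma complexify_flat_le_ker_iff {T : Finset κ} {i : κ} :
    A.complexify.flat T ≤ LinearMap.ker (A.complexify.covec i) ↔
      ∀ v : Fin n → ℝ, (∀ j ∈ T, A.normal j ⬝ᵥ v = 0) → A.normal i ⬝ᵥ v = 0 := by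
  constructor
  · intro h v hv
    have hvi := h (mem_flat_iff.mpr fun j hj => by
      rw [complexify_covec_ofReal A j v, hv j hj, Complex.ofReal_zero])
    rwa [LinearMap.mem_ker, complexify_covec_ofReal, Complex.ofReal_eq_zero] at hvi
  · intro h v hv
    rw [mem_flat_iff] at hv
    refine Complex.ext ?_ ?_
    · rw [re_complexify_covec]
      exact h _ fun j hj => by rw [← re_complexify_covec, hv j hj, Complex.zero_re]
    · rw [im_complexify_covec]
      exact h _ fun j hj => by rw [← im_complexify_covec, hv j hj, Complex.zero_im]

lemma exists_dotProduct_eq_one {T : Finset κ} {i : κ}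
    (h : ¬ A.complexify.flat T ≤ LinearMap.ker (A.complexify.covec i)) :
    ∃ v : Fin n → ℝ, (∀ j ∈ T, A.normal j ⬝ᵥ v = 0) ∧ A.normal i ⬝ᵥ v = 1 := by
  rw [complexify_flat_le_ker_iff] at h
  push Not at h
  obtain ⟨w, hw, hiw⟩ := h
  refine ⟨(A.normal i ⬝ᵥ w)⁻¹ • w, fun j hj => ?_, ?_⟩
  · rw [dotProduct_smul, hw j hj, smul_zero]
  · rw [dotProduct_smul, smul_eq_mul, inv_mul_cancel₀ hiw]

variable {b : κ → ℝ} {S T : Finset κ} {i : κ}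

lemma IsGenericDeformation.affineForm_ne_zero (hb : A.IsGenericDeformation b) (hi : i ∉ T)
    (hdep : ∀ v : Fin n → ℝ, (∀ j ∈ T, A.normal j ⬝ᵥ v = 0) → A.normal i ⬝ᵥ v = 0)
    {x : Fin n → ℝ} (hx : ∀ j ∈ T, affineForm A b j x = 0) : affineForm A b i x ≠ 0 := by
  classical
  intro hix
  have hcommon : (⋂ j ∈ insert i T, A.affineHyperplane b j).Nonempty :=
    ⟨x, Set.mem_iInter₂.mpr fun j hj => sub_eq_zero.mp <|
      (Finset.forall_mem_insert i T fun j => affineForm A b j x = 0).mpr ⟨hix, hx⟩ j hj⟩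
  obtain ⟨v, hv⟩ :=
    surjective_dotProduct_iff.mpr ((hb _).mp hcommon) fun j => if j = i then 1 else 0
  replace hv : ∀ j ∈ insert i T, A.normal j ⬝ᵥ v = if j = i then 1 else 0 :=
    fun j hj => congrFun hv ⟨j, hj⟩
  rw [Finset.forall_mem_insert, if_pos rfl] at hv
  refine one_ne_zero (hv.1.symm.trans (hdep v fun j hj => ?_))
  rw [hv.2 j hj, if_neg (ne_of_mem_of_not_mem hj hi)]

lemma IsGenericDeformation.exists_affineForm_eq (hb : A.IsGenericDeformation b) (hi : i ∉ T)
    (hdep : ∀ v : Fin n → ℝ, (∀ j ∈ T, A.normal j ⬝ᵥ v = 0) → A.normal i ⬝ᵥ v = 0)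
    {x₀ : Fin n → ℝ} (hx₀ : ∀ j ∈ T, affineForm A b j x₀ = 0) :
    ∃ c ≠ 0, ∀ x, (∀ j ∈ T, affineForm A b j x = 0) → affineForm A b i x = c := by
  refine ⟨_, hb.affineForm_ne_zero hi hdep hx₀, fun x hx => ?_⟩
  have hdiff := hdep (x - x₀) fun j hj => by
    rw [dotProduct_sub, sub_eq_zero.mp (hx j hj), sub_eq_zero.mp (hx₀ j hj), sub_self]
  rw [affineForm, affineForm, sub_eq_zero.mp ((dotProduct_sub _ _ _).symm.trans hdiff)]

lemma exists_affineForm_insert_eq_zero [DecidableEq κ] {v : Fin n → ℝ}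
    (hv : ∀ j ∈ T, A.normal j ⬝ᵥ v = 0) (hiv : A.normal i ⬝ᵥ v = 1)
    (hT : ∃ x, ∀ j ∈ T, affineForm A b j x = 0) :
    ∃ x, ∀ j ∈ insert i T, affineForm A b j x = 0 := by
  obtain ⟨x, hx⟩ := hT
  refine ⟨x + (-affineForm A b i x) • v, (Finset.forall_mem_insert _ _ _).mpr ⟨?_, fun j hj => ?_⟩⟩
  · rw [affineForm_add_smul, hiv, mul_one, add_neg_cancel]
  · rw [affineForm_add_smul, hv j hj, hx j hj, mul_zero, add_zero]

theorem IsGenericDeformation.exists_polynomial_reducedHilb [DecidableEq κ]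
    (hb : A.IsGenericDeformation b) (hST : Disjoint S T)
    (hT : ∃ x, ∀ j ∈ T, affineForm A b j x = 0) :
    ∃ P : Polynomial ℤ,
      (P : PowerSeries ℤ) = reducedHilb (S.val.map A.complexify.covec) (A.complexify.flat T) ∧
      P.eval 1 = (signPatterns A b S T).card := by
  induction S using Finset.induction_on generalizing T with
  | empty =>
    obtain ⟨x, hx⟩ := hT
    have hcell : (cell A b T ∅ ∅).Nonempty := ⟨x, hx, by simp⟩
    refine ⟨1, ?_, ?_⟩
    · rw [Finset.empty_val, Multiset.map_zero, reducedHilb_zero, Polynomial.coe_one]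
    · simp [signPatterns, Finset.filter_singleton, hcell]
  | insert i S hi ih =>
    rw [Finset.disjoint_insert_left] at hST
    rw [Finset.insert_val_of_notMem hi, Multiset.map_cons]
    obtain ⟨P, hP, hP1⟩ := ih hST.2 hT
    by_cases h : A.complexify.flat T ≤ LinearMap.ker (A.complexify.covec i)
    · obtain ⟨x, hx⟩ := hT
      obtain ⟨c, hc, hconst⟩ :=
        hb.exists_affineForm_eq hST.1 (complexify_flat_le_ker_iff.mp h) hx
      exact ⟨P, by rw [reducedHilb_cons_of_le_ker h, hP],
        by rw [card_signPatterns_insert_of_parallel hi hc hconst, hP1]⟩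
    · obtain ⟨v, hv, hiv⟩ := exists_dotProduct_eq_one h
      obtain ⟨Q, hQ, hQ1⟩ := ih (Finset.disjoint_insert_right.mpr ⟨hi, hST.2⟩)
        (exists_affineForm_insert_eq_zero hv hiv hT)
      refine ⟨Polynomial.X * P + Q, ?_, ?_⟩
      · rw [reducedHilb_cons h, Polynomial.coe_add, Polynomial.coe_mul, Polynomial.coe_X, hP, hQ,
          flat_insert]
      · rw [Polynomial.eval_add, Polynomial.eval_mul, Polynomial.eval_X, one_mul, hP1, hQ1,
          card_signPatterns_insert_of_transverse hi hv hiv, Nat.cast_add]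

end Multiarrangement

section

variable {n : ℕ} {κ : Type*} {A : Multiarrangement ℝ n κ} {b : κ → ℝ} {x : Fin n → ℝ}

lemma mem_affineComplement_iff : x ∈ A.affineComplement b ↔ ∀ i, affineForm A b i x ≠ 0 := by
  simp only [Multiarrangement.affineComplement, Set.mem_compl_iff, Set.mem_iUnion, not_exists]
  exact forall_congr' fun i => not_congr sub_eq_zero.symm

section

variable [Fintype κ] [DecidableEq κ] {p : Finset κ}

lemma cell_subset_affineComplement : cell A b ∅ p (Finset.univ \ p) ⊆ A.affineComplement b := by
  refine fun x hx => mem_affineComplement_iff.mpr fun i => ?_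
  by_cases hi : i ∈ p
  · exact (hx.2.1 i hi).ne'
  · exact (hx.2.2 i (Finset.mem_sdiff.mpr ⟨Finset.mem_univ i, hi⟩)).ne

lemma mem_cell_iff_eq_filter (hx : x ∈ A.affineComplement b) :
    x ∈ cell A b ∅ p (Finset.univ \ p) ↔
      p = Finset.univ.filter fun i => 0 < affineForm A b i x := by
  have hne := mem_affineComplement_iff.mp hx
  simp only [cell, Set.mem_ofPred_eq, Finset.notMem_empty, false_imp_iff, implies_true, true_and,
    Finset.mem_sdiff, Finset.mem_univ, Finset.ext_iff, Finset.mem_filter_univ, ← forall_and]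
  refine forall_congr' fun i => ?_
  rcases (hne i).lt_or_gt with h | h
  · simp only [h, h.not_gt, iff_false, imp_false, implies_true, and_true]
  · simp only [h, h.not_gt, iff_true, implies_true, true_and, imp_false, not_not]

lemma connectedComponentIn_affineComplement (hx : x ∈ cell A b ∅ p (Finset.univ \ p)) :
    connectedComponentIn (A.affineComplement b) x = cell A b ∅ p (Finset.univ \ p) := by
  have hconn := isPreconnected_connectedComponentIn (F := A.affineComplement b) (x := x)
  have hxC := mem_connectedComponentIn (cell_subset_affineComplement hx)
  have hcont (i : κ) := (continuous_affineForm A b i).continuousOn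
    (s := connectedComponentIn (A.affineComplement b) x)
  have hzero (i : κ) :
      (0 : ℝ) ∉ affineForm A b i '' connectedComponentIn (A.affineComplement b) x := by
    rintro ⟨z, hz, hz0⟩
    exact mem_affineComplement_iff.mp (connectedComponentIn_subset _ _ hz) i hz0
  refine Set.Subset.antisymm (fun y hy => ⟨by simp, fun i hi => ?_, fun i hi => ?_⟩)
    ((convex_cell A b _ _ _).isPreconnected.subset_connectedComponentIn hx
      cell_subset_affineComplement)
  · by_contra! hle
    exact hzero i (hconn.intermediate_value hy hxC (hcont i) ⟨hle, (hx.2.1 i hi).le⟩)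
  · by_contra! hle
    exact hzero i (hconn.intermediate_value hxC hy (hcont i) ⟨(hx.2.2 i hi).le, hle⟩)

lemma regions_eq_image_cell : A.regions b =
    (fun p => cell A b ∅ p (Finset.univ \ p)) '' signPatterns A b Finset.univ ∅ := by
  ext R
  simp only [Multiarrangement.regions, Set.mem_image, Finset.mem_coe, mem_signPatterns,
    Finset.subset_univ, true_and]
  constructor
  · rintro ⟨x, hx, rfl⟩
    have hxp := (mem_cell_iff_eq_filter hx).mpr rfl
    exact ⟨_, ⟨x, hxp⟩, (connectedComponentIn_affineComplement hxp).symm⟩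
  · rintro ⟨p, ⟨x, hx⟩, rfl⟩
    exact ⟨x, cell_subset_affineComplement hx, connectedComponentIn_affineComplement hx⟩

lemma injOn_cell : Set.InjOn (fun p => cell A b ∅ p (Finset.univ \ p))
    (signPatterns A b Finset.univ ∅ : Set (Finset κ)) := by
  intro p hp q _ hpq
  obtain ⟨x, hx⟩ := (mem_signPatterns.mp hp).2
  have hxF := cell_subset_affineComplement hx
  have hxq : x ∈ cell A b ∅ q (Finset.univ \ q) := hpq.subset hx
  exact ((mem_cell_iff_eq_filter hxF).mp hx).trans ((mem_cell_iff_eq_filter hxF).mp hxq).symm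

lemma ncard_regions : (A.regions b).ncard = (signPatterns A b Finset.univ ∅).card := by
  rw [regions_eq_image_cell, injOn_cell.ncard_image, Set.ncard_coe_finset]

end

lemma finite_regions [Finite κ] (A : Multiarrangement ℝ n κ) (b : κ → ℝ) :
    (A.regions b).Finite := by
  classical
  have := Fintype.ofFinite κ
  rw [regions_eq_image_cell]
  exact (Finset.finite_toSet _).image _

theorem Multiarrangement.IsGenericDeformation.exists_polynomial_hilbPoly [Finite κ]
    (hb : A.IsGenericDeformation b) : ∃ P : Polynomial ℤ,
      (P : PowerSeries ℤ) = hilbPoly (powerIdeal A.complexify 1) ∧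
      P.eval 1 = (A.regions b).ncard := by
  classical
  have := Fintype.ofFinite κ
  rw [hilbPoly_powerIdeal, ← reducedHilb_top, ncard_regions, covectors,
    ← A.complexify.flat_empty]
  exact hb.exists_polynomial_reducedHilb (Finset.disjoint_empty_right _)
    ⟨0, fun j hj => absurd hj (Finset.notMem_empty j)⟩

lemma finite_and_finrank_superExternal {ι : Type*} [Finite ι] (A : Multiarrangement ℂ n ι)
    {P : Polynomial ℤ} (hP : (P : PowerSeries ℤ) = hilbPoly (powerIdeal A.double 1)) :
    Module.Finite ℂ (SuperExternal A) ∧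
      (Module.finrank ℂ (SuperExternal A) : ℤ) = P.eval 1 := by
  have := Fintype.ofFinite ι
  have hspec : specSq (quotHilb A.covectors ⊤) = P := by
    rw [hP, ← subst_hilbSuper_superIdeal, ← specSq_apply, hilbSuper_superIdeal]
  obtain ⟨F, hF, hF1⟩ := exists_mvPolynomial_of_specSq_eq (coeff_quotHilb_nonneg _ _) hspec
  rw [← hF1]
  refine finite_and_finrank_quotient ?_ (hF.trans (hilbSuper_superIdeal A).symm)
  rw [superIdeal_eq_superPower]
  exact isGraded_superPower _ _

lemma Multiarrangement.complexify_double {ι : Type*} (A : Multiarrangement ℝ n ι) :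
    A.double.complexify = A.complexify.double := by
  simp only [double, complexify, mk.injEq]
  funext i j
  cases i <;> rfl

end

end Superzonotopal

end

theorem corollary4p8 {n : ℕ} {ι : Type*} [Finite ι]
    (A : Superzonotopal.Multiarrangement ℝ n ι) :
    MvPowerSeries.subst ![(PowerSeries.X : PowerSeries ℤ) ^ 2, PowerSeries.X]
        (Superzonotopal.hilbSuper (Superzonotopal.superIdeal A.complexify)) =
      Superzonotopal.hilbPoly (Superzonotopal.powerIdeal A.double.complexify 1) ∧
    Module.Finite ℂ (Superzonotopal.SuperExternal A.complexify) ∧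
    (∃ b : ι ⊕ ι → ℝ, A.double.IsGenericDeformation b) ∧
    ∀ b : ι ⊕ ι → ℝ, A.double.IsGenericDeformation b →
      (A.double.regions b).Finite ∧
      Module.finrank ℂ (Superzonotopal.SuperExternal A.complexify) =
        (A.double.regions b).ncard := by
  have hdim {b : ι ⊕ ι → ℝ} (hb : A.double.IsGenericDeformation b) :
      Module.Finite ℂ (Superzonotopal.SuperExternal A.complexify) ∧
      Module.finrank ℂ (Superzonotopal.SuperExternal A.complexify) =
        (A.double.regions b).ncard := by
    obtain ⟨P, hP, hregions⟩ := hb.exists_polynomial_hilbPoly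
    rw [A.complexify_double] at hP
    obtain ⟨hfin, hrank⟩ := Superzonotopal.finite_and_finrank_superExternal A.complexify hP
    exact ⟨hfin, Nat.cast_injective (hrank.trans hregions)⟩
  obtain ⟨b₀, hb₀⟩ := A.double.exists_isGenericDeformation
  refine ⟨?_, (hdim hb₀).1, ⟨b₀, hb₀⟩, fun b hb =>
    ⟨Superzonotopal.finite_regions A.double b, (hdim hb).2⟩⟩
  rw [Superzonotopal.subst_hilbSuper_superIdeal, A.complexify_double]
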